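/- All objects are smooth. A contact sub-Riemannian (resp. sub-Lorentzian) structure on a $3$-dimensional manifold $M$ is a pair $(D,g)$, where $D\subset TM$ is a rank-$2$ contact distribution and $g$ is a metric on $D$ of signature $(+,+)$ (resp. $(-,+)$). Let $X_0$ be its Reeb vector field, which is defined locally, up to the sign fixed by an orientation of $D$, by the conditions that $[X_0,X_1]$ and $[X_0,X_2]$ are sections of $D$ and $[X_1,X_2]\equiv X_0 \bmod D$ for an oriented orthonormal frame $(X_1,X_2)$ of $D$. Put $h=\tfrac12\mathcal L_{X_0}g$, a bilinear form on $D$; the condition $h=0$ does not depend on the orientation. A (local) quotient $N=M/X_0$ is a surface $N$ with a submersion $\pi\colon U\to N$ from an open set $U\subset M$ carrying a Reeb field $X_0$ onto $N$, whose fibres are exactly the trajectories of $X_0$ in $U$. A projection of $g$ to $N$ is a metric $\tilde g$ on $N$ with $\tilde g(d\pi\,u,d\pi\,v)=g(u,v)$ for all $u,v\in D_p$, $p\in U$. Theorem. Let $(D,g)$ be a contact sub-Riemannian or sub-Lorentzian structure on a $3$-dimensional manifold $M$ with $h=0$. Then on every local quotient $N=M/X_0$ there is exactly one projection $\tilde g$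 of $g$, and it determines $(D,g)$ uniquely up to local isometry, in the following sense. Let $(M_i,D_i,g_i)$, $i=1,2$, be two such structures with $h_i=0$, let $\pi_i\colon U_i\to N_i$ be local quotients with projected metrics $\tilde g_i$, and let $\varphi$ be an isometry from an open subset of $(N_1,\tilde g_1)$ onto an open subset of $(N_2,\tilde g_2)$. Then for all $p_1\in U_1$ and $p_2\in U_2$ such that $\varphi$ is defined at $\pi_1(p_1)$ and $\varphi(\pi_1(p_1))=\pi_2(p_2)$ there is a diffeomorphism $\Phi$ from an open neighbourhood of $p_1$ in $U_1$ onto an open neighbourhood of $p_2$ in $U_2$ with $\Phi(p_1)=p_2$, with $\pi_2\circ\Phi=\varphi\circ\pi_1$ (in particular $\pi_1$ maps the domain of $\Phi$ into that of $\varphi$), and which is an isometry of the contact structures: $d\Phi(D_1)=D_2$ and $g_2(d\Phi\,u,d\Phi\,v)=g_1(u,v)$ for $u,v\in D_1$. -/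

import Mathlib

open Set
open scoped Manifold ContDiff

noncomputable section

namespace SubPR

/-- `C^∞` vector field on the set `W` of a manifold modelled on `ℝⁿ`; a vector field is a total
function, and nothing is required of its values outside `W`. -/
def SmoothVF {n : ℕ} {M : Type*} [TopologicalSpace M]
    [ChartedSpace (EuclideanSpace ℝ (Fin n)) M] [IsManifold (𝓡 n) ∞ M]
    (X : ∀ p : M, TangentSpace (𝓡 n) p) (W : Set M) : Prop :=
  ContMDiffOn (𝓡 n) (𝓡 n).tangent ∞
    (fun p => (⟨p, X p⟩ : TangentBundle (𝓡 n) M)) W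

/-- A pseudo-Riemannian metric on a surface `N`: a smooth field of nondegenerate symmetric
bilinear forms on the tangent spaces. -/
@[ext]
structure SurfaceMetric (N : Type*) [TopologicalSpace N]
    [ChartedSpace (EuclideanSpace ℝ (Fin 2)) N] [IsManifold (𝓡 2) ∞ N] where
  /-- the bilinear form on each tangent space -/
  form : ∀ y : N, LinearMap.BilinForm ℝ (TangentSpace (𝓡 2) y)
  symm : ∀ y u v, form y u v = form y v u
  nondeg : ∀ y u, (∀ v, form y u v = 0) → u = 0
  smooth : ∀ (W : Set N), IsOpen W → ∀ X Y : ∀ y : N, TangentSpace (𝓡 2) y,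
    SmoothVF X W → SmoothVF Y W →
    ContMDiffOn (𝓡 2) 𝓘(ℝ, ℝ) ∞ (fun y => form y (X y) (Y y)) W

/-- A contact sub-Riemannian or sub-Lorentzian structure `(D, g)` on a 3-manifold `M`. -/
structure ContactStructure (M : Type*) [TopologicalSpace M]
    [ChartedSpace (EuclideanSpace ℝ (Fin 3)) M] [IsManifold (𝓡 3) ∞ M] where
  /-- the distribution -/
  D : ∀ p : M, Submodule ℝ (TangentSpace (𝓡 3) p)
  finrank_D : ∀ p, Module.finrank ℝ (D p) = 2
  /-- `D` is smooth: near every point it has a frame of smooth vector fields -/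
  smooth_D : ∀ p : M, ∃ W : Set M, IsOpen W ∧ p ∈ W ∧ ∃ X Y : ∀ q, D q,
    SmoothVF (fun q => (X q : TangentSpace (𝓡 3) q)) W ∧
    SmoothVF (fun q => (Y q : TangentSpace (𝓡 3) q)) W ∧
    ∀ q ∈ W, LinearIndependent ℝ ![X q, Y q]
  /-- `D` is a contact distribution: it is nowhere involutive -/
  contact : ∀ W : Set M, IsOpen W → ∀ X Y : ∀ q, D q,
    SmoothVF (fun q => (X q : TangentSpace (𝓡 3) q)) W →
    SmoothVF (fun q => (Y q : TangentSpace (𝓡 3) q)) W →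
    ∀ p ∈ W, LinearIndependent ℝ ![X p, Y p] →
    VectorField.mlieBracket (𝓡 3) (fun q => (X q : TangentSpace (𝓡 3) q))
      (fun q => (Y q : TangentSpace (𝓡 3) q)) p ∉ D p
  /-- the metric on `D` -/
  g : ∀ p : M, LinearMap.BilinForm ℝ (D p)
  symm_g : ∀ p u v, g p u v = g p v u
  smooth_g : ∀ W : Set M, IsOpen W → ∀ X Y : ∀ q, D q,
    SmoothVF (fun q => (X q : TangentSpace (𝓡 3) q)) W →
    SmoothVF (fun q => (Y q : TangentSpace (𝓡 3) q)) W →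
    ContMDiffOn (𝓡 3) 𝓘(ℝ, ℝ) ∞ (fun q => g q (X q) (Y q)) W
  /-- sub-Riemannian, signature `(+,+)`, or sub-Lorentzian, signature `(-,+)`: as `D p` is
  two-dimensional, the latter holds as soon as both signs are attained -/
  signature : (∀ p, ∀ u : D p, u ≠ 0 → 0 < g p u u) ∨
    (∀ p, (∃ u : D p, g p u u < 0) ∧ ∃ v : D p, 0 < g p v v)

section Structure

variable {M : Type*} [TopologicalSpace M]
  [ChartedSpace (EuclideanSpace ℝ (Fin 3)) M] [IsManifold (𝓡 3) ∞ M]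

/-- The derivative of a function at `p` in the direction of the tangent vector `v`. -/
def dirDeriv (f : M → ℝ) (p : M) (v : TangentSpace (𝓡 3) p) : ℝ :=
  mfderiv (𝓡 3) 𝓘(ℝ, ℝ) f p v

/-- The vector field on `M` underlying a section of `D`. -/
def ContactStructure.vf (S : ContactStructure M) (X : ∀ q, S.D q) :
    ∀ q : M, TangentSpace (𝓡 3) q :=
  fun q => (X q : TangentSpace (𝓡 3) q)

/-- `(X₁, X₂)` is a smooth orthonormal frame of `(D, g)` on `W`. The value of `g(X₁, X₁)` is
forced by the signature: `1` in the sub-Riemannian and `-1` in the sub-Lorentzian case. -/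
structure ContactStructure.IsOrthonormalFrame (S : ContactStructure M) (W : Set M)
    (X₁ X₂ : ∀ q, S.D q) : Prop where
  smooth_fst : SmoothVF (S.vf X₁) W
  smooth_snd : SmoothVF (S.vf X₂) W
  fst_fst : ∀ q ∈ W, S.g q (X₁ q) (X₁ q) = 1 ∨ S.g q (X₁ q) (X₁ q) = -1
  snd_snd : ∀ q ∈ W, S.g q (X₂ q) (X₂ q) = 1
  fst_snd : ∀ q ∈ W, S.g q (X₁ q) (X₂ q) = 0

/-- `X₀` is a Reeb vector field of `(D, g)` on the open set `V`: near every point of `V` there is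
an orthonormal frame `(X₁, X₂)` with `[X₀, X₁], [X₀, X₂] ∈ D` and `[X₁, X₂] = X₀ mod D`.
The Reeb field depends on the local orientation of `D` given by the frame only through its sign;
no global orientation of `D` is fixed. -/
structure ContactStructure.IsReeb (S : ContactStructure M) (V : Set M)
    (X₀ : ∀ q : M, TangentSpace (𝓡 3) q) : Prop where
  isOpen : IsOpen V
  smooth : SmoothVF X₀ V
  frame : ∀ p ∈ V, ∃ W : Set M, IsOpen W ∧ p ∈ W ∧ W ⊆ V ∧ ∃ X₁ X₂ : ∀ q, S.D q,
    S.IsOrthonormalFrame W X₁ X₂ ∧ ∀ q ∈ W,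
      VectorField.mlieBracket (𝓡 3) X₀ (S.vf X₁) q ∈ S.D q ∧
      VectorField.mlieBracket (𝓡 3) X₀ (S.vf X₂) q ∈ S.D q ∧
      VectorField.mlieBracket (𝓡 3) (S.vf X₁) (S.vf X₂) q - X₀ q ∈ S.D q

/-- The value at `p` of `h(X, Y) = ½ (L_{X₀} g)(X, Y)`, that is of
`½ (X₀(g(X, Y)) - g([X₀, X], Y) - g(X, [X₀, Y]))`, for sections `X`, `Y` of `D`
whose brackets with `X₀` are tangent to `D` at `p`. -/
def ContactStructure.h (S : ContactStructure M) (X₀ : ∀ q : M, TangentSpace (𝓡 3) q)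
    (X Y : ∀ q, S.D q) (p : M)
    (hX : VectorField.mlieBracket (𝓡 3) X₀ (S.vf X) p ∈ S.D p)
    (hY : VectorField.mlieBracket (𝓡 3) X₀ (S.vf Y) p ∈ S.D p) : ℝ :=
  (1 / 2 : ℝ) *
    (dirDeriv (fun q => S.g q (X q) (Y q)) p (X₀ p)
      - S.g p ⟨_, hX⟩ (Y p) - S.g p (X p) ⟨_, hY⟩)

/-- The condition `h = 0`: the form `h = ½ L_{X₀} g` on `D` vanishes identically, for every
(local) Reeb field `X₀`. The brackets `[X₀, X]` and `[X₀, Y]` always lie in `D`. -/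
def ContactStructure.HVanishes (S : ContactStructure M) : Prop :=
  ∀ (V : Set M) (X₀ : ∀ q : M, TangentSpace (𝓡 3) q), S.IsReeb V X₀ →
    ∀ W : Set M, IsOpen W → W ⊆ V → ∀ X Y : ∀ q, S.D q,
      SmoothVF (S.vf X) W → SmoothVF (S.vf Y) W → ∀ p ∈ W, ∀ hX hY,
        S.h X₀ X Y p hX hY = 0

/-- `p` and `q` lie on one trajectory of `X₀` in `U`. -/
def SameTrajectory (X₀ : ∀ q : M, TangentSpace (𝓡 3) q) (U : Set M) (p q : M) : Prop :=
  ∃ (γ : ℝ → M) (a b : ℝ), IsMIntegralCurveOn γ X₀ (uIcc a b) ∧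
    MapsTo γ (uIcc a b) U ∧ γ a = p ∧ γ b = q

variable {N : Type*} [TopologicalSpace N]
  [ChartedSpace (EuclideanSpace ℝ (Fin 2)) N] [IsManifold (𝓡 2) ∞ N]

/-- The surface `N`, with the projection `π`, is the (local) quotient manifold `U / X₀` of an open
set `U` of `M` by a Reeb field `X₀` on `U`: `π` is a smooth submersion of `U` onto `N` whose fibres
are exactly the trajectories of `X₀` in `U`. The values of `π` outside `U` are irrelevant. -/
structure ContactStructure.IsReebQuotient (S : ContactStructure M) (U : Set M)
    (X₀ : ∀ q : M, TangentSpace (𝓡 3) q) (π : M → N) : Prop where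
  reeb : S.IsReeb U X₀
  smooth : ContMDiffOn (𝓡 3) (𝓡 2) ∞ π U
  surj : SurjOn π U univ
  submersion : ∀ p ∈ U, Function.Surjective (mfderiv (𝓡 3) (𝓡 2) π p)
  fibre : ∀ p ∈ U, ∀ q ∈ U, π p = π q ↔ SameTrajectory X₀ U p q

/-- The metric `gN` on `N` is the projection of `g`: its pullback by `π` to `D` is `g` on `U`. -/
def ContactStructure.IsProjection (S : ContactStructure M) (U : Set M) (π : M → N)
    (gN : SurfaceMetric N) : Prop :=
  ∀ p ∈ U, ∀ u v : S.D p,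
    gN.form (π p) (mfderiv (𝓡 3) (𝓡 2) π p (u : TangentSpace (𝓡 3) p))
      (mfderiv (𝓡 3) (𝓡 2) π p (v : TangentSpace (𝓡 3) p)) = S.g p u v

end Structure

/-- A diffeomorphism `φ` between open sets of two surfaces is an isometry of the metrics. -/
def IsSurfaceIsometry {N₁ N₂ : Type*}
    [TopologicalSpace N₁] [ChartedSpace (EuclideanSpace ℝ (Fin 2)) N₁] [IsManifold (𝓡 2) ∞ N₁]
    [TopologicalSpace N₂] [ChartedSpace (EuclideanSpace ℝ (Fin 2)) N₂] [IsManifold (𝓡 2) ∞ N₂]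
    (g₁ : SurfaceMetric N₁) (g₂ : SurfaceMetric N₂)
    (φ : PartialDiffeomorph (𝓡 2) (𝓡 2) N₁ N₂ ∞) : Prop :=
  ∀ y ∈ φ.source, ∀ u v : TangentSpace (𝓡 2) y,
    g₂.form (φ y) (mfderiv (𝓡 2) (𝓡 2) φ y u) (mfderiv (𝓡 2) (𝓡 2) φ y v) = g₁.form y u v

/-- A diffeomorphism `Φ` between open sets of two 3-manifolds is an isometry of the contact
structures: its differential maps `D₁` onto `D₂` and is a linear isometry of `g₁` and `g₂`. -/
def IsContactIsometry {M₁ M₂ : Type*}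
    [TopologicalSpace M₁] [ChartedSpace (EuclideanSpace ℝ (Fin 3)) M₁] [IsManifold (𝓡 3) ∞ M₁]
    [TopologicalSpace M₂] [ChartedSpace (EuclideanSpace ℝ (Fin 3)) M₂] [IsManifold (𝓡 3) ∞ M₂]
    (S₁ : ContactStructure M₁) (S₂ : ContactStructure M₂)
    (Φ : PartialDiffeomorph (𝓡 3) (𝓡 3) M₁ M₂ ∞) : Prop :=
  ∀ q ∈ Φ.source,
    (∀ w : TangentSpace (𝓡 3) (Φ q),
      w ∈ S₂.D (Φ q) ↔ ∃ u ∈ S₁.D q, mfderiv (𝓡 3) (𝓡 3) Φ q u = w) ∧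
    ∀ (u v : S₁.D q)
      (hu : mfderiv (𝓡 3) (𝓡 3) Φ q (u : TangentSpace (𝓡 3) q) ∈ S₂.D (Φ q))
      (hv : mfderiv (𝓡 3) (𝓡 3) Φ q (v : TangentSpace (𝓡 3) q) ∈ S₂.D (Φ q)),
      S₂.g (Φ q) ⟨_, hu⟩ ⟨_, hv⟩ = S₁.g q u v

end SubPR

end

noncomputable section

set_option linter.unusedSectionVars false

open Filter Topology VectorField

namespace SubPR

/-! ### Smooth dependence of integrals on parameters. -/

section ParametricIntegral

variable {H : Type} [NormedAddCommGroup H] [NormedSpace ℝ H] [FiniteDimensional ℝ H]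

/-! The Reeb field is transverse to `D`, and its flow preserves `D`; the condition `h = 0` says that
the flow preserves `g` as well. So the structure should descend to the quotient, up to the data of a
1-form whose differential is determined by the metric.

Concretely, near each point of `U` there are coordinates `(y, z)`, with `y` pulled back from `N`, in
which `X₀ = ∂_z` (`exists_flowBox`). Transversality makes `D` the graph `dz = a` of a field of
1-forms on the base. The conditions `[X₀, Xᵢ] ∈ D` say that `a` does not depend on `z`, `h = 0` says
the same of the metric `G` read on the base, and `[X₁, X₂] ≡ X₀` says that `da` is 1 on the
projected orthonormal frame, so that `da` is an area form of `G`. This is `nonempty_normalForm`.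

Projection: `dπ` is bijective from each `D_p` to the tangent plane of `N`, which gives uniqueness.
For existence, two points of a fibre lie on a trajectory; inside a flow box they induce the same
metric, and connectedness carries this along the trajectory (`compat_of_eq`).

Rigidity: let `ψ` be the isometry in charts. Then `ψ^* da₂` and `da₁` are area forms of the same
metric, so they agree up to a constant sign `δ` on a ball, and the Poincaré lemma gives `f` with `df
= ψ^* a₂ - δ a₁` (`exists_primitive_of_curl`). The map `(y, z) ↦ (ψ y, δ z + f y)` takes `dz = a₁`
to `dz = a₂` and covers the isometry. The constant of integration in `f` is used to send `p₁` to
`p₂`. Both signatures are treated at once through the absolute value of the Gram determinant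
(`curl_sq`). -/

lemma hasFDerivAt_integral_of_contDiff_one {E : Type} [NormedAddCommGroup E] [NormedSpace ℝ E]
    [CompleteSpace E] {F : H × ℝ → E} (hF : ContDiff ℝ 1 F) (x : H) :
    HasFDerivAt (fun x => ∫ t in (0 : ℝ)..1, F (x, t))
      (∫ t in (0 : ℝ)..1, (fderiv ℝ F (x, t)).comp (ContinuousLinearMap.inl ℝ H ℝ)) x := by
  have hc : Continuous fun q : H × ℝ =>
      (fderiv ℝ F q).comp (ContinuousLinearMap.inl ℝ H ℝ) :=
    (hF.continuous_fderiv one_ne_zero).clm_comp continuous_const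
  -- The continuous derivative is bounded on this compact set, which supplies a constant dominating
  -- function.
  have hK : IsCompact (Metric.closedBall x 1 ×ˢ Icc (0 : ℝ) 1) :=
    (isCompact_closedBall x 1).prod isCompact_Icc
  obtain ⟨C, hC⟩ := (hK.image hc.norm).bddAbove
  refine intervalIntegral.hasFDerivAt_integral_of_dominated_of_fderiv_le (𝕜 := ℝ)
    (F := fun x t => F (x, t))
    (F' := fun x t => (fderiv ℝ F (x, t)).comp (ContinuousLinearMap.inl ℝ H ℝ))
    (bound := fun _ => C) (Metric.closedBall_mem_nhds x one_pos) ?_ ?_ ?_ ?_ ?_ ?_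
  · refine Eventually.of_forall fun y => Continuous.aestronglyMeasurable ?_
    exact hF.continuous.comp (by fun_prop)
  · exact (hF.continuous.comp (by fun_prop : Continuous fun t : ℝ => (x, t))).intervalIntegrable _ _
  · exact (hc.comp (by fun_prop : Continuous fun t : ℝ => (x, t))).aestronglyMeasurable
  · refine Eventually.of_forall fun t ht y hy => hC ⟨(y, t), ⟨hy, ?_⟩, rfl⟩
    rw [uIoc_of_le zero_le_one] at ht
    exact ⟨ht.1.le, ht.2⟩
  · exact intervalIntegrable_const
  · refine Eventually.of_forall fun t _ y _ => ?_
    have h1 : HasFDerivAt F (fderiv ℝ F (y, t)) (y, t) :=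
      (hF.differentiable one_ne_zero _).hasFDerivAt
    exact h1.comp y (hasFDerivAt_prodMk_left y t)

/-- Integrals of smooth functions depend smoothly on parameters. -/
lemma contDiff_integral_param (n : ℕ) : ∀ {E : Type} [NormedAddCommGroup E] [NormedSpace ℝ E]
    [CompleteSpace E] {F : H × ℝ → E} (_ : ContDiff ℝ ∞ F),
    ContDiff ℝ n (fun x => ∫ t in (0 : ℝ)..1, F (x, t)) := by
  induction n with
  | zero =>
    intro E _ _ _ F hF
    have h : Continuous (fun x => ∫ t in (0 : ℝ)..1, F (x, t)) :=
      continuous_iff_continuousAt.2 fun x =>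
        (hasFDerivAt_integral_of_contDiff_one (hF.of_le (by simp)) x).continuousAt
    exact_mod_cast contDiff_zero.2 h
  | succ n ih =>
    intro E _ _ _ F hF
    have h := hasFDerivAt_integral_of_contDiff_one (hF.of_le (by simp))
    push_cast
    refine (contDiff_succ_iff_fderiv (n := n)).2 ⟨fun x => (h x).differentiableAt, by simp, ?_⟩
    have e : fderiv ℝ (fun x => ∫ t in (0 : ℝ)..1, F (x, t)) =
        fun x => ∫ t in (0 : ℝ)..1,
          (fderiv ℝ F (x, t)).comp (ContinuousLinearMap.inl ℝ H ℝ) :=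
      funext fun x => (h x).fderiv
    rw [e]
    exact ih (F := fun q => (fderiv ℝ F q).comp (ContinuousLinearMap.inl ℝ H ℝ))
      ((hF.fderiv_right (by simp)).clm_comp contDiff_const)

/-- A smooth function has a smooth primitive along the last coordinate, locally. -/
lemma exists_primitive_snd {ρ : H × ℝ → ℝ} {x₀ : H × ℝ} {O : Set (H × ℝ)} (hO : IsOpen O)
    (hx₀ : x₀ ∈ O) (hρ : ContDiffOn ℝ ∞ ρ O) :
    ∃ w : H × ℝ → ℝ, ContDiff ℝ ∞ w ∧ ∀ᶠ x in 𝓝 x₀, fderiv ℝ w x (0, 1) = ρ x := by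
  -- Since the identity is only claimed near `x₀`, `ρ` may be cut off to a function smooth on the
  -- whole space.
  obtain ⟨χ, hχs, hχd, hχ1⟩ : ∃ χ : H × ℝ → ℝ, tsupport χ ⊆ O ∧ ContDiff ℝ ∞ χ ∧
      ∀ᶠ x in 𝓝 x₀, χ x = 1 := by
    obtain ⟨r, hr, hrO⟩ := Metric.nhds_basis_closedBall.mem_iff.1 (hO.mem_nhds hx₀)
    let f : ContDiffBump x₀ := ⟨r / 2, r, by positivity, by linarith⟩
    exact ⟨f, by rw [f.tsupport_eq]; exact hrO, f.contDiff, f.eventuallyEq_one⟩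
  set σ : H × ℝ → ℝ := fun x => χ x * ρ x with hσ
  have hσd : ContDiff ℝ ∞ σ := by
    rw [contDiff_iff_contDiffAt]
    intro x
    by_cases hx : x ∈ tsupport χ
    · exact hχd.contDiffAt.mul ((hρ x (hχs hx)).contDiffAt (hO.mem_nhds (hχs hx)))
    · have h0 : σ =ᶠ[𝓝 x] fun _ => 0 := by
        filter_upwards [(isClosed_tsupport χ).isOpen_compl.mem_nhds hx] with y hy
        simp [hσ, image_eq_zero_of_notMem_tsupport hy]
      exact contDiffAt_const.congr_of_eventuallyEq h0
  -- This is the integral of `σ (x.1, ·)` from `0` to `x.2`, rescaled to fixed limits so that smooth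
  -- dependence on parameters applies.
  refine ⟨fun x => ∫ t in (0 : ℝ)..1, x.2 * σ (x.1, t * x.2), ?_, ?_⟩
  · refine contDiff_infty.2 fun n => contDiff_integral_param n
      (F := fun q : (H × ℝ) × ℝ => q.1.2 * σ (q.1.1, q.2 * q.1.2)) ?_
    fun_prop
  · filter_upwards [hχ1] with x hx
    have hd : ContDiff ℝ ∞ fun x : H × ℝ => ∫ t in (0 : ℝ)..1, x.2 * σ (x.1, t * x.2) := by
      refine contDiff_infty.2 fun n => contDiff_integral_param n
        (F := fun q : (H × ℝ) × ℝ => q.1.2 * σ (q.1.1, q.2 * q.1.2)) ?_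
      fun_prop
    have h1 := ((hd.differentiable (by simp)) x).hasFDerivAt
    have h2 : HasDerivAt (fun s : ℝ => ((x.1, s) : H × ℝ)) (0, 1) x.2 :=
      (hasDerivAt_const _ _).prodMk (hasDerivAt_id _)
    have h3 := h1.comp_hasDerivAt (f := fun s : ℝ => ((x.1, s) : H × ℝ)) x.2 h2
    have h4 : ((fun x : H × ℝ => ∫ t in (0 : ℝ)..1, x.2 * σ (x.1, t * x.2)) ∘
        fun s : ℝ => ((x.1, s) : H × ℝ)) = fun s => ∫ t in (0 : ℝ)..s, σ (x.1, t) := by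
      ext s
      have := intervalIntegral.smul_integral_comp_mul_right (a := 0) (b := 1)
        (fun t => σ (x.1, t)) s
      simp only [Function.comp, intervalIntegral.integral_const_mul]
      simpa using this
    rw [h4] at h3
    have hc : Continuous fun t => σ (x.1, t) := hσd.continuous.comp (by fun_prop)
    have h5 := hc.deriv_integral _ 0 x.2
    rw [h3.deriv] at h5
    rw [h5]; simp [hσ, hx]

end ParametricIntegral

/-! ### Primitives of closed 1-forms. -/

section Poincare

/-- The Poincaré lemma for smooth `1`-forms on an open convex set. -/
lemma exists_contDiffOn_primitive {E : Type*} [NormedAddCommGroup E] [NormedSpace ℝ E] {s : Set E}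
    (hs : Convex ℝ s) (hso : IsOpen s) {η : E → E →L[ℝ] ℝ} (hη : ContDiffOn ℝ ∞ η s)
    (hd : ∀ a ∈ s, ∀ x y, fderiv ℝ η a x y = fderiv ℝ η a y x) :
    ∃ f : E → ℝ, ContDiffOn ℝ ∞ f s ∧ ∀ a ∈ s, HasFDerivAt f (η a) a := by
  obtain ⟨f, hf⟩ := hs.exists_forall_hasFDerivAt_of_fderiv_symmetric hso
    (hη.differentiableOn (by simp)) hd
  refine ⟨f, ?_, hf⟩
  have : ContDiffOn ℝ (∞ + 1) f s := by
    refine (contDiffOn_succ_iff_fderiv_of_isOpen (n := ∞) hso).2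
      ⟨fun a ha => (hf a ha).differentiableAt.differentiableWithinAt, by simp, ?_⟩
    exact hη.congr fun a ha => (hf a ha).fderiv
  exact this.of_le (by simp)

end Poincare

/-! ### The smooth inverse function theorem. -/

section InverseFunction

variable {E E' F : Type*} [NormedAddCommGroup E] [NormedSpace ℝ E] [NormedAddCommGroup F]
  [NormedSpace ℝ F] [NormedAddCommGroup E'] [NormedSpace ℝ E'] [CompleteSpace E]

/-- The smooth inverse function theorem in a vector space. -/
lemma exists_partialDiffeomorph_of_contDiffOn {f : E → F} {W : Set E} (hW : IsOpen W)
    (hf : ContDiffOn ℝ ∞ f W) {a : E} (ha : a ∈ W) (hf' : (fderiv ℝ f a).IsInvertible) :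
    ∃ e : PartialDiffeomorph 𝓘(ℝ, E) 𝓘(ℝ, F) E F ∞, a ∈ e.source ∧ e.source ⊆ W ∧
      ∀ x, e x = f x := by
  obtain ⟨f', hff'⟩ := hf'
  have hfa : ContDiffAt ℝ ∞ f a := hf.contDiffAt (hW.mem_nhds ha)
  have hda : HasFDerivAt f (f' : E →L[ℝ] F) a := by
    rw [hff']; exact (hfa.differentiableAt (by simp)).hasFDerivAt
  let e₀ := hfa.toOpenPartialHomeomorph f hda (by simp)
  -- Restricting to the open set where the derivative is invertible makes the inverse smooth on the
  -- whole target, not only at `f a`.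
  let O : Set E := W ∩ fderiv ℝ f ⁻¹' range ((↑) : (E ≃L[ℝ] F) → E →L[ℝ] F)
  have hO : IsOpen O := (hf.continuousOn_fderiv_of_isOpen hW (by simp)).isOpen_inter_preimage hW
    ContinuousLinearEquiv.isOpen
  let e := e₀.restrOpen O hO
  have heO : ∀ x ∈ e.source, x ∈ O := fun x hx => by
    rw [OpenPartialHomeomorph.restrOpen_source] at hx; exact hx.2
  refine ⟨⟨e.toPartialEquiv, e.open_source, e.open_target, ?_, ?_⟩, ?_, ?_, fun x => rfl⟩
  · rw [contMDiffOn_iff_contDiffOn]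
    exact hf.mono fun x hx => (heO x hx).1
  · rw [contMDiffOn_iff_contDiffOn]
    intro y hy
    have hx : e.symm y ∈ O := heO _ (e.map_target hy)
    obtain ⟨g, hg⟩ := hx.2
    have hfx : ContDiffAt ℝ ∞ f (e.symm y) := hf.contDiffAt (hW.mem_nhds hx.1)
    refine (e.contDiffAt_symm (f₀' := g) hy ?_ hfx).contDiffWithinAt
    rw [hg]
    exact (hfx.differentiableAt (by simp)).hasFDerivAt
  · change a ∈ (e₀.restrOpen O hO).source
    rw [OpenPartialHomeomorph.restrOpen_source]
    exact ⟨hfa.mem_toOpenPartialHomeomorph_source hda (by simp), ha, ⟨f', hff'⟩⟩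
  · exact fun x hx => (heO x hx).1

end InverseFunction

/-! ### Transport of vector fields and brackets by partial diffeomorphisms. -/

section PartialDiffeo

variable {n : ℕ} {M : Type*} [TopologicalSpace M] [ChartedSpace (EuclideanSpace ℝ (Fin n)) M]
  {F : Type*} [NormedAddCommGroup F] [NormedSpace ℝ F]

lemma isInvertible_mfderiv_partialDiffeomorph {E H E' H' M' : Type*} [NormedAddCommGroup E]
    [NormedSpace ℝ E] [TopologicalSpace H] {I : ModelWithCorners ℝ E H} [NormedAddCommGroup E']
    [NormedSpace ℝ E'] [TopologicalSpace H'] {I' : ModelWithCorners ℝ E' H'}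
    {M : Type*} [TopologicalSpace M] [ChartedSpace H M] [TopologicalSpace M'] [ChartedSpace H' M']
    (e : PartialDiffeomorph I I' M M' ∞) {x : M} (hx : x ∈ e.source) :
    (mfderiv I I' e x).IsInvertible :=
  ⟨(PartialDiffeomorph.isLocalDiffeomorphAt I I' ∞ e hx).mfderivToContinuousLinearEquiv (by simp), rfl⟩

/-- The preferred chart at a point as a partial diffeomorphism. -/
def chartDiffeo [IsManifold (𝓡 n) ∞ M] (a : M) :
    PartialDiffeomorph (𝓡 n) 𝓘(ℝ, EuclideanSpace ℝ (Fin n)) M (EuclideanSpace ℝ (Fin n)) ∞ where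
  toPartialEquiv := extChartAt (𝓡 n) a
  open_source := isOpen_extChartAt_source a
  open_target := isOpen_extChartAt_target a
  contMDiffOn_toFun := by
    rw [extChartAt_source]; exact contMDiffOn_extChartAt
  contMDiffOn_invFun := contMDiffOn_extChartAt_symm a

lemma mem_chartDiffeo_source [IsManifold (𝓡 n) ∞ M] (a : M) :
    a ∈ (chartDiffeo (n := n) a).source :=
  mem_extChartAt_source a

/-- Restriction of a partial diffeomorphism to the preimage of an open set. -/
def restrTarget {E H E' H' M' : Type*} [NormedAddCommGroup E]
    [NormedSpace ℝ E] [TopologicalSpace H] {I : ModelWithCorners ℝ E H} [NormedAddCommGroup E']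
    [NormedSpace ℝ E'] [TopologicalSpace H'] {I' : ModelWithCorners ℝ E' H'}
    {M : Type*} [TopologicalSpace M] [ChartedSpace H M] [TopologicalSpace M'] [ChartedSpace H' M']
    (e : PartialDiffeomorph I I' M M' ∞) (O : Set M') (hO : IsOpen O) :
    PartialDiffeomorph I I' M M' ∞ :=
  e.trans ⟨PartialEquiv.ofSet O, hO, hO, contMDiffOn_id, contMDiffOn_id⟩

/-- The smooth inverse function theorem on a manifold. -/
lemma exists_partialDiffeomorph [IsManifold (𝓡 n) ∞ M] {f : M → F} {W : Set M} (hW : IsOpen W)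
    (hf : ContMDiffOn (𝓡 n) 𝓘(ℝ, F) ∞ f W) {a : M} (ha : a ∈ W)
    (hf' : (mfderiv (𝓡 n) 𝓘(ℝ, F) f a).IsInvertible) :
    ∃ e : PartialDiffeomorph (𝓡 n) 𝓘(ℝ, F) M F ∞, a ∈ e.source ∧ e.source ⊆ W ∧
      ∀ x ∈ e.source, e x = f x := by
  let c : PartialDiffeomorph (𝓡 n) 𝓘(ℝ, EuclideanSpace ℝ (Fin n)) M _ ∞ := chartDiffeo a
  have hac : a ∈ c.source := mem_chartDiffeo_source a
  let W' := c.target ∩ c.symm ⁻¹' W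
  have hW' : IsOpen W' := c.symm.toOpenPartialHomeomorph.isOpen_inter_preimage hW
  have hca : c a ∈ W' := ⟨c.map_source hac, by
    change c.symm (c a) ∈ W
    rw [show c.symm (c a) = a from c.left_inv hac]; exact ha⟩
  have hg : ContDiffOn ℝ ∞ (f ∘ c.symm) W' := by
    rw [← contMDiffOn_iff_contDiffOn]
    exact hf.comp (c.symm.contMDiffOn.mono inter_subset_left) inter_subset_right
  have hgd : (fderiv ℝ (f ∘ c.symm) (c a)).IsInvertible := by
    have e0 : c.symm (c a) = a := c.left_inv hac
    rw [← mfderiv_eq_fderiv, mfderiv_comp (I' := 𝓡 n) (c a)]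
    · refine ContinuousLinearMap.IsInvertible.comp ?_ ?_
      · rw [e0]; exact hf'
      · exact isInvertible_mfderiv_partialDiffeomorph c.symm (c.map_source hac)
    · rw [e0]; exact (hf.contMDiffAt (hW.mem_nhds ha)).mdifferentiableAt (by simp)
    · exact c.symm.mdifferentiableAt (by simp) (c.map_source hac)
  obtain ⟨e, hae, hes, hef⟩ := exists_partialDiffeomorph_of_contDiffOn hW' hg hca hgd
  refine ⟨c.trans e, ⟨hac, hae⟩, ?_, ?_⟩
  · rintro x ⟨hx, hx'⟩
    have := (hes hx').2
    change c.symm (c x) ∈ W at this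
    rwa [show c.symm (c x) = x from c.left_inv hx] at this
  · rintro x ⟨hx, hx'⟩
    change e (c x) = f x
    rw [hef]
    exact congrArg f (c.left_inv hx)

/-- A map of a vector space to itself as a vector field in the sense of manifolds. -/
def asVF (Z : F → F) : ∀ x : F, TangentSpace 𝓘(ℝ, F) x := Z

lemma contMDiffAt_asVF {Z : F → F} {x : F} :
    ContMDiffAt 𝓘(ℝ, F) 𝓘(ℝ, F).tangent ∞
      (fun p => (⟨p, asVF Z p⟩ : TangentBundle 𝓘(ℝ, F) F)) x ↔ ContDiffAt ℝ ∞ Z x :=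
  contMDiffAt_vectorSpace_iff_contDiffAt

/-- The image of a vector field under a partial diffeomorphism into a vector space. -/
def push (e : PartialDiffeomorph (𝓡 n) 𝓘(ℝ, F) M F ∞) (X : ∀ p : M, TangentSpace (𝓡 n) p) :
    F → F :=
  fun x => mfderiv (𝓡 n) 𝓘(ℝ, F) e (e.symm x) (X (e.symm x))

/-- The preimage of a vector field under a partial diffeomorphism into a vector space. -/
def pull (e : PartialDiffeomorph (𝓡 n) 𝓘(ℝ, F) M F ∞) (Z : F → F) :
    ∀ p : M, TangentSpace (𝓡 n) p :=
  mpullback (𝓡 n) 𝓘(ℝ, F) e (asVF Z)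

variable (e : PartialDiffeomorph (𝓡 n) 𝓘(ℝ, F) M F ∞)

lemma symm_apply_apply {q : M} (hq : q ∈ e.source) : e.symm (e q) = q := e.left_inv hq

lemma push_apply (X : ∀ p : M, TangentSpace (𝓡 n) p) {q : M} (hq : q ∈ e.source) :
    push e X (e q) = mfderiv (𝓡 n) 𝓘(ℝ, F) e q (X q) := by
  unfold push
  rw [symm_apply_apply e hq]

lemma mfderiv_pull (Z : F → F) {q : M} (hq : q ∈ e.source) :
    mfderiv (𝓡 n) 𝓘(ℝ, F) e q (pull e Z q) = Z (e q) :=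
  (isInvertible_mfderiv_partialDiffeomorph e hq).self_apply_inverse (Z (e q))

lemma pull_push (X : ∀ p : M, TangentSpace (𝓡 n) p) {q : M} (hq : q ∈ e.source) :
    pull e (push e X) q = X q := by
  have h := (isInvertible_mfderiv_partialDiffeomorph e hq).inverse_apply_self (X q)
  exact (congrArg (mfderiv (𝓡 n) 𝓘(ℝ, F) e q).inverse (push_apply e X hq)).trans h

/-- The differentials of `e` and `e.symm` are mutually inverse. The smoothness results for pullbacks
thereby become available for `push`. -/
lemma push_eq_mpullback_symm (X : ∀ p : M, TangentSpace (𝓡 n) p) {y : F} (hy : y ∈ e.target) :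
    asVF (push e X) y = mpullback 𝓘(ℝ, F) (𝓡 n) e.symm X y := by
  have hs : e.symm y ∈ e.source := e.map_target hy
  have hy' : e (e.symm y) = y := e.right_inv hy
  have hA := isInvertible_mfderiv_partialDiffeomorph e.symm hy
  have hcomp : (mfderiv (𝓡 n) 𝓘(ℝ, F) e (e.symm y)).comp (mfderiv 𝓘(ℝ, F) (𝓡 n) e.symm y) =
      ContinuousLinearMap.id ℝ F := by
    rw [← mfderiv_comp y (e.mdifferentiableAt (by simp) hs)
      (e.symm.mdifferentiableAt (by simp) hy)]
    have : e ∘ e.symm =ᶠ[𝓝 y] id := by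
      filter_upwards [e.open_target.mem_nhds hy] with z hz using e.right_inv hz
    rw [this.mfderiv_eq]
    exact mfderiv_id
  have hX := hA.self_apply_inverse (X (e.symm y))
  have := congrArg (mfderiv (𝓡 n) 𝓘(ℝ, F) e (e.symm y)) hX
  refine this.symm.trans ?_
  exact congrArg (fun L : F →L[ℝ] F => L ((mfderiv 𝓘(ℝ, F) (𝓡 n) e.symm y).inverse
    (X (e.symm y)))) hcomp

variable [IsManifold (𝓡 n) ∞ M]

lemma smoothVF_pull {Z : F → F} {O : Set F} (hO : IsOpen O) (hZ : ContDiffOn ℝ ∞ Z O) :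
    SmoothVF (pull e Z) (e.source ∩ e ⁻¹' O) := by
  intro q hq
  refine ContMDiffAt.contMDiffWithinAt ?_
  refine ContMDiffAt.mpullback_vectorField_preimage (n := ∞) ?_
    (e.contMDiffOn.contMDiffAt (e.open_source.mem_nhds hq.1))
    (isInvertible_mfderiv_partialDiffeomorph e hq.1) (by simp)
  exact contMDiffAt_asVF.2 (hZ.contDiffAt (hO.mem_nhds hq.2))

lemma contDiffOn_push [CompleteSpace F] {X : ∀ p : M, TangentSpace (𝓡 n) p} {W : Set M} (hW : IsOpen W)
    (hX : SmoothVF X W) : ContDiffOn ℝ ∞ (push e X) (e.target ∩ e.symm ⁻¹' W) := by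
  intro x hx
  have h1 : ContMDiffAt 𝓘(ℝ, F) 𝓘(ℝ, F).tangent ∞
      (fun p => (⟨p, mpullback 𝓘(ℝ, F) (𝓡 n) e.symm X p⟩ : TangentBundle 𝓘(ℝ, F) F)) x :=
    ContMDiffAt.mpullback_vectorField_preimage (n := ∞) (hX.contMDiffAt (hW.mem_nhds hx.2))
      (e.symm.contMDiffOn.contMDiffAt (e.open_target.mem_nhds hx.1))
      (isInvertible_mfderiv_partialDiffeomorph e.symm hx.1) (by simp)
  refine (contMDiffAt_asVF.1 (h1.congr_of_eventuallyEq ?_)).contDiffWithinAt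
  filter_upwards [e.open_target.mem_nhds hx.1] with y hy
  refine congrArg (fun v => (⟨y, v⟩ : TangentBundle 𝓘(ℝ, F) F)) ?_
  exact push_eq_mpullback_symm e X hy

/-- Naturality of the bracket under pullback, since near `q` the fields `X`, `Y` are the pullbacks
of their own images. Every bracket condition on `M` is thus turned into one between fields on a
vector space. -/
lemma mfderiv_mlieBracket [CompleteSpace F] {X Y : ∀ p : M, TangentSpace (𝓡 n) p} {W : Set M} (hW : IsOpen W)
    (hX : SmoothVF X W) (hY : SmoothVF Y W) {q : M} (hq : q ∈ e.source) (hqW : q ∈ W) :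
    mfderiv (𝓡 n) 𝓘(ℝ, F) e q (mlieBracket (𝓡 n) X Y q) =
      lieBracket ℝ (push e X) (push e Y) (e q) := by
  have hO : IsOpen (e.target ∩ e.symm ⁻¹' W) :=
    e.symm.toOpenPartialHomeomorph.isOpen_inter_preimage hW
  have hm : e q ∈ e.target ∩ e.symm ⁻¹' W :=
    ⟨e.map_source hq, by rw [mem_preimage, symm_apply_apply e hq]; exact hqW⟩
  have hd : ∀ {Z : ∀ p : M, TangentSpace (𝓡 n) p}, SmoothVF Z W →
      MDifferentiableAt 𝓘(ℝ, F) 𝓘(ℝ, F).tangent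
        (fun p => (⟨p, asVF (push e Z) p⟩ : TangentBundle 𝓘(ℝ, F) F)) (e q) := fun {Z} hZ =>
    (contMDiffAt_asVF.2
      ((contDiffOn_push e hW hZ).contDiffAt (hO.mem_nhds hm))).mdifferentiableAt (by simp)
  have : IsManifold (𝓡 n) (minSmoothness ℝ 2) M := by
    rw [minSmoothness_of_isRCLikeNormedField]; exact IsManifold.of_le (n := ∞) ENat.LEInfty.out
  have h1 := mpullback_mlieBracket (n := ∞) (hd hX) (hd hY)
    (e.contMDiffOn.contMDiffAt (e.open_source.mem_nhds hq))
    (by rw [minSmoothness_of_isRCLikeNormedField]; exact ENat.LEInfty.out)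
  have h2 : ∀ Z : ∀ p : M, TangentSpace (𝓡 n) p,
      mpullback (𝓡 n) 𝓘(ℝ, F) e (asVF (push e Z)) =ᶠ[𝓝 q] Z := fun Z => by
    filter_upwards [e.open_source.mem_nhds hq] with y hy
    exact pull_push e Z hy
  rw [Filter.EventuallyEq.mlieBracket_vectorField_eq (h2 X) (h2 Y)] at h1
  rw [← h1]
  have h3 := mfderiv_pull e (mlieBracket 𝓘(ℝ, F) (asVF (push e X)) (asVF (push e Y))) hq
  refine h3.trans ?_
  rw [← mlieBracketWithin_univ, mlieBracketWithin_eq_lieBracketWithin]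
  exact congrFun (lieBracketWithin_univ (V := push e X) (W := push e Y)) (e q)

end PartialDiffeo

/-- The kernel of `L` is a line by rank and nullity, hence is spanned by `R`, and `l` is nonzero
there. So the product is injective between spaces of equal dimension. -/
lemma isInvertible_prod_of_surjective {L : EuclideanSpace ℝ (Fin 3) →L[ℝ] EuclideanSpace ℝ (Fin 2)}
    (hL : Function.Surjective L) {R : EuclideanSpace ℝ (Fin 3)} (hR : L R = 0)
    {l : EuclideanSpace ℝ (Fin 3) →L[ℝ] ℝ} (hl : l R ≠ 0) : (L.prod l).IsInvertible := by
  have hker : Module.finrank ℝ (LinearMap.ker L.toLinearMap) = 1 := by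
    have h1 := LinearMap.finrank_range_add_finrank_ker L.toLinearMap
    have h2 : LinearMap.range L.toLinearMap = ⊤ := LinearMap.range_eq_top.2 hL
    rw [h2, finrank_top] at h1
    simp only [finrank_euclideanSpace, Fintype.card_fin] at h1
    omega
  have hR0 : R ≠ 0 := fun h => hl (by rw [h, map_zero])
  have hinj : Function.Injective (L.prod l).toLinearMap := by
    rw [injective_iff_map_eq_zero]
    intro v hv
    have hv1 : L v = 0 := congrArg Prod.fst hv
    have hv2 : l v = 0 := congrArg Prod.snd hv
    obtain ⟨c, hc⟩ := (finrank_eq_one_iff_of_nonzero' (⟨R, hR⟩ : LinearMap.ker L.toLinearMap)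
      (fun h => hR0 (congrArg Subtype.val h))).1 hker ⟨v, hv1⟩
    have hc' : c • R = v := congrArg Subtype.val hc
    rw [← hc', map_smul, smul_eq_mul, mul_eq_zero, or_iff_left hl] at hv2
    rw [← hc', hv2, zero_smul]
  let E := (LinearEquiv.ofInjectiveOfFinrankEq (L.prod l).toLinearMap hinj
    (by simp)).toContinuousLinearEquiv
  exact ⟨E, by ext v <;> rfl⟩

lemma hasMFDerivAt_prodMk_space {E H F G : Type*} [NormedAddCommGroup E] [NormedSpace ℝ E]
    [TopologicalSpace H] {I : ModelWithCorners ℝ E H} [NormedAddCommGroup F] [NormedSpace ℝ F]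
    [NormedAddCommGroup G] [NormedSpace ℝ G] {M : Type*} [TopologicalSpace M] [ChartedSpace H M]
    {f : M → F} {g : M → G} {q : M} {f' : E →L[ℝ] F} {g' : E →L[ℝ] G}
    (hf : HasMFDerivAt I 𝓘(ℝ, F) f q f') (hg : HasMFDerivAt I 𝓘(ℝ, G) g q g') :
    HasMFDerivAt I 𝓘(ℝ, F × G) (fun x => (f x, g x)) q (f'.prod g') :=
  ⟨hf.1.prodMk hg.1, hf.2.prodMk hg.2⟩

/-! ### Flow boxes of the Reeb field. -/

section Reeb

variable {M : Type*} [TopologicalSpace M]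
  [ChartedSpace (EuclideanSpace ℝ (Fin 3)) M] [IsManifold (𝓡 3) ∞ M]
  {N : Type*} [TopologicalSpace N]
  [ChartedSpace (EuclideanSpace ℝ (Fin 2)) N] [IsManifold (𝓡 2) ∞ N]
  {S : ContactStructure M} {U : Set M} {R : ∀ p : M, TangentSpace (𝓡 3) p} {π : M → N}

namespace ContactStructure

lemma IsOrthonormalFrame.linearIndependent {W : Set M} {X₁ X₂ : ∀ q, S.D q}
    (h : S.IsOrthonormalFrame W X₁ X₂) {q : M} (hq : q ∈ W) :
    LinearIndependent ℝ ![X₁ q, X₂ q] := by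
  rw [LinearIndependent.pair_iff]
  intro s t hst
  have h1 := congrArg (S.g q (X₁ q)) hst
  have h2 := congrArg (S.g q (X₂ q)) hst
  have h3 := h.fst_fst q hq
  rw [map_add, map_smul, map_smul, h.fst_snd q hq, map_zero] at h1
  rw [map_add, map_smul, map_smul, S.symm_g, h.fst_snd q hq, h.snd_snd q hq, map_zero] at h2
  simp only [smul_eq_mul] at h1 h2
  refine ⟨?_, by linarith⟩
  rcases h3 with h3 | h3 <;> rw [h3] at h1 <;> linarith

/-- If `R p` were in `D`, the relation `[X₁, X₂] ≡ R mod D` would put `[X₁, X₂]` in `D`, against the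
contact condition. -/
lemma IsReeb.notMem (h : S.IsReeb U R) {p : M} (hp : p ∈ U) : R p ∉ S.D p := by
  obtain ⟨W, hW, hpW, -, X₁, X₂, hX, hbr⟩ := h.frame p hp
  intro hR
  have h1 := (hbr p hpW).2.2
  have h2 := (S.D p).add_mem h1 hR
  rw [sub_add_cancel] at h2
  exact S.contact W hW X₁ X₂ hX.smooth_fst hX.smooth_snd p hpW (hX.linearIndependent hpW) h2

/-- A short integral curve through `p` stays in `U`, hence in one fibre of `π`; differentiate the
constant function `π ∘ γ` at time `0`. -/
lemma IsReebQuotient.mfderiv_reeb (h : S.IsReebQuotient U R π) {p : M} (hp : p ∈ U) :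
    mfderiv (𝓡 3) (𝓡 2) π p (R p) = 0 := by
  have hU := h.reeb.isOpen
  have hR : ContMDiffAt (𝓡 3) (𝓡 3).tangent 1
      (fun q => (⟨q, R q⟩ : TangentBundle (𝓡 3) M)) p :=
    (h.reeb.smooth.contMDiffAt (hU.mem_nhds hp)).of_le (by simp)
  obtain ⟨γ, hγ0, hγ⟩ := exists_isMIntegralCurveAt_of_contMDiffAt_boundaryless (I := 𝓡 3) 0 hR
  have hγ1 := hγ.self_of_nhds
  have hcont : ContinuousAt γ 0 := hγ1.continuousAt
  obtain ⟨ε, hε, hγε⟩ := isMIntegralCurveAt_iff'.1 hγ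
  have hev : ∀ᶠ t in 𝓝 (0 : ℝ), γ t ∈ U := hcont (by rw [hγ0]; exact hU.mem_nhds hp)
  obtain ⟨δ, hδ, hγδ⟩ := Metric.eventually_nhds_iff_ball.1 hev
  have hconst : π ∘ γ =ᶠ[𝓝 0] fun _ => π p := by
    filter_upwards [Metric.ball_mem_nhds (0 : ℝ) (lt_min hε hδ)] with t ht
    have h0 : (0 : ℝ) ∈ Metric.ball (0 : ℝ) (min ε δ) := Metric.mem_ball_self (lt_min hε hδ)
    have hsub : uIcc 0 t ⊆ Metric.ball (0 : ℝ) (min ε δ) := by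
      rw [← segment_eq_uIcc]
      exact (convex_ball _ _).segment_subset h0 ht
    have hmap : MapsTo γ (uIcc 0 t) U := fun s hs =>
      hγδ s (Metric.ball_subset_ball (min_le_right _ _) (hsub hs))
    refine ((h.fibre p hp (γ t) (hmap right_mem_uIcc)).2 ⟨γ, 0, t, ?_, hmap, hγ0, rfl⟩).symm
    exact hγε.mono (hsub.trans (Metric.ball_subset_ball (min_le_left _ _)))
  have hπ : MDifferentiableAt (𝓡 3) (𝓡 2) π (γ 0) := by
    rw [hγ0]
    exact (h.smooth.contMDiffAt (hU.mem_nhds hp)).mdifferentiableAt (by simp)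
  have hcomp := hπ.hasMFDerivAt.comp (0 : ℝ) hγ1
  have hz : HasMFDerivAt 𝓘(ℝ, ℝ) (𝓡 2) (π ∘ γ) (0 : ℝ) 0 :=
    (hasMFDerivAt_const (π p) (0 : ℝ)).congr_of_eventuallyEq hconst
  have heq := hasMFDerivAt_unique hcomp hz
  have := congrArg (fun L : ℝ →L[ℝ] EuclideanSpace ℝ (Fin 2) => L 1) heq
  rw [← hγ0]
  refine Eq.trans ?_ this
  change _ = (mfderiv (𝓡 3) (𝓡 2) π (γ 0)) ((1 : ℝ) • R (γ 0))
  rw [one_smul]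

end ContactStructure

/-- A chart of `M` in which the Reeb field is the last coordinate field and `π` is the projection
along it, over the preferred chart of `N` at `y₀`. -/
structure FlowBox (U : Set M) (R : ∀ p : M, TangentSpace (𝓡 3) p) (π : M → N) (y₀ : N) where
  /-- the chart -/
  e : PartialDiffeomorph (𝓡 3) 𝓘(ℝ, EuclideanSpace ℝ (Fin 2) × ℝ) M
    (EuclideanSpace ℝ (Fin 2) × ℝ) ∞
  /-- the centre of the image -/
  c : EuclideanSpace ℝ (Fin 2) × ℝ
  /-- the size of the image -/
  r : ℝ
  r_pos : 0 < r
  target_eq : e.target = Metric.ball c r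
  source_subset : e.source ⊆ U
  proj_mem : ∀ q ∈ e.source, π q ∈ (chartDiffeo (n := 2) y₀).source
  fst_eq : ∀ q ∈ e.source, (e q).1 = chartDiffeo (n := 2) y₀ (π q)
  reeb : ∀ q ∈ e.source, mfderiv (𝓡 3) 𝓘(ℝ, EuclideanSpace ℝ (Fin 2) × ℝ) e q (R q) = (0, 1)

/-- The inverse function theorem applies to `π`, read in a chart, paired with `τ`: `dπ` is onto and
kills `R`, while `dτ` does not. -/
lemma exists_chart_of_transverse (h : S.IsReebQuotient U R π) {p : M} {W : Set M}
    (hW : IsOpen W) (hpW : p ∈ W) (hWU : W ⊆ U) {τ : M → ℝ}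
    (hτ : ContMDiffOn (𝓡 3) 𝓘(ℝ, ℝ) ∞ τ W) (hτR : mfderiv (𝓡 3) 𝓘(ℝ, ℝ) τ p (R p) ≠ (0 : ℝ)) :
    ∃ e : PartialDiffeomorph (𝓡 3) 𝓘(ℝ, EuclideanSpace ℝ (Fin 2) × ℝ) M
      (EuclideanSpace ℝ (Fin 2) × ℝ) ∞, p ∈ e.source ∧ e.source ⊆ W ∧
      (∀ q ∈ e.source, π q ∈ (chartDiffeo (n := 2) (π p)).source ∧
        e q = (chartDiffeo (n := 2) (π p) (π q), τ q)) ∧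
      ∀ q ∈ e.source, mfderiv (𝓡 3) 𝓘(ℝ, EuclideanSpace ℝ (Fin 2) × ℝ) e q (R q) =
        (0, mfderiv (𝓡 3) 𝓘(ℝ, ℝ) τ q (R q)) := by
  let κ := chartDiffeo (n := 2) (π p)
  let W' := W ∩ π ⁻¹' κ.source
  have hW' : IsOpen W' := (h.smooth.continuousOn.mono hWU).isOpen_inter_preimage hW κ.open_source
  have hpW' : p ∈ W' := ⟨hpW, mem_chartDiffeo_source _⟩
  have hκπ : ContMDiffOn (𝓡 3) 𝓘(ℝ, EuclideanSpace ℝ (Fin 2)) ∞ (fun q => κ (π q)) W' :=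
    κ.contMDiffOn.comp (h.smooth.mono (inter_subset_left.trans hWU)) inter_subset_right
  have hf : ContMDiffOn (𝓡 3) 𝓘(ℝ, EuclideanSpace ℝ (Fin 2) × ℝ) ∞
      (fun q => (κ (π q), τ q)) W' := hκπ.prodMk_space (hτ.mono inter_subset_left)
  have hder : ∀ q ∈ W', HasMFDerivAt (𝓡 3) 𝓘(ℝ, EuclideanSpace ℝ (Fin 2) × ℝ)
      (fun q => (κ (π q), τ q)) q
      (((mfderiv (𝓡 2) 𝓘(ℝ, EuclideanSpace ℝ (Fin 2)) κ (π q)).comp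
        (mfderiv (𝓡 3) (𝓡 2) π q)).prod (mfderiv (𝓡 3) 𝓘(ℝ, ℝ) τ q)) := by
    intro q hq
    have h1 : MDifferentiableAt (𝓡 3) (𝓡 2) π q :=
      (h.smooth.contMDiffAt (h.reeb.isOpen.mem_nhds (hWU hq.1))).mdifferentiableAt (by simp)
    have h2 := κ.mdifferentiableAt (by simp) hq.2
    have h3 : MDifferentiableAt (𝓡 3) 𝓘(ℝ, ℝ) τ q :=
      (hτ.contMDiffAt (hW.mem_nhds hq.1)).mdifferentiableAt (by simp)
    exact hasMFDerivAt_prodMk_space (h2.hasMFDerivAt.comp q h1.hasMFDerivAt) h3.hasMFDerivAt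
  have hinv : (mfderiv (𝓡 3) 𝓘(ℝ, EuclideanSpace ℝ (Fin 2) × ℝ)
      (fun q => (κ (π q), τ q)) p).IsInvertible := by
    rw [(hder p hpW').mfderiv]
    refine isInvertible_prod_of_surjective (R := R p) ?_ ?_ hτR
    · exact (isInvertible_mfderiv_partialDiffeomorph κ hpW'.2).surjective.comp
        (h.submersion p (hWU hpW))
    · have := congrArg (mfderiv (𝓡 2) 𝓘(ℝ, EuclideanSpace ℝ (Fin 2)) κ (π p))
        (h.mfderiv_reeb (hWU hpW))
      rw [map_zero] at this
      exact this
  obtain ⟨e, hpe, hes, hef⟩ := exists_partialDiffeomorph hW' hf hpW' hinv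
  refine ⟨e, hpe, fun q hq => (hes hq).1, fun q hq => ⟨(hes hq).2, hef q hq⟩, fun q hq => ?_⟩
  have hd : HasMFDerivAt (𝓡 3) 𝓘(ℝ, EuclideanSpace ℝ (Fin 2) × ℝ) e q _ :=
    (hder q (hes hq)).congr_of_eventuallyEq (by
      filter_upwards [e.open_source.mem_nhds hq] with y hy using hef y hy)
  rw [hd.mfderiv]
  have := congrArg (mfderiv (𝓡 2) 𝓘(ℝ, EuclideanSpace ℝ (Fin 2)) κ (π q))
    (h.mfderiv_reeb (hWU (hes hq).1))
  rw [map_zero] at this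
  exact Prod.ext this rfl

/-- Take a linear function of a chart, namely the inner product with the image of `R p`, which is
nonzero because `R p` is not in `D`. -/
lemma exists_transverse (h : S.IsReebQuotient U R π) {p : M} (hp : p ∈ U) :
    ∃ (W : Set M) (τ : M → ℝ), IsOpen W ∧ p ∈ W ∧ W ⊆ U ∧ ContMDiffOn (𝓡 3) 𝓘(ℝ, ℝ) ∞ τ W ∧
      mfderiv (𝓡 3) 𝓘(ℝ, ℝ) τ p (R p) ≠ (0 : ℝ) := by
  let c := chartDiffeo (n := 3) p
  have hpc : p ∈ c.source := mem_chartDiffeo_source p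
  have hR0 : R p ≠ 0 := fun h0 => h.reeb.notMem hp (by rw [h0]; exact (S.D p).zero_mem)
  let v : EuclideanSpace ℝ (Fin 3) := mfderiv (𝓡 3) 𝓘(ℝ, EuclideanSpace ℝ (Fin 3)) c p (R p)
  have hv : v ≠ 0 := fun h0 => hR0
    ((isInvertible_mfderiv_partialDiffeomorph c hpc).injective (h0.trans (map_zero _).symm))
  let l : EuclideanSpace ℝ (Fin 3) →L[ℝ] ℝ := innerSL ℝ v
  refine ⟨U ∩ c.source, l ∘ c, h.reeb.isOpen.inter c.open_source, ⟨hp, hpc⟩, inter_subset_left,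
    l.contMDiff.comp_contMDiffOn (c.contMDiffOn.mono inter_subset_right), ?_⟩
  have hd := l.hasMFDerivAt.comp p (c.mdifferentiableAt (by simp) hpc).hasMFDerivAt
  rw [hd.mfderiv]
  change l v ≠ 0
  simpa [l] using hv

/-- Every point has a neighbourhood with a coordinate along which the Reeb field is the
coordinate field. -/
lemma exists_transverse_eq_one (h : S.IsReebQuotient U R π) {p : M} (hp : p ∈ U) :
    ∃ (W : Set M) (τ : M → ℝ), IsOpen W ∧ p ∈ W ∧ W ⊆ U ∧ ContMDiffOn (𝓡 3) 𝓘(ℝ, ℝ) ∞ τ W ∧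
      ∀ q ∈ W, mfderiv (𝓡 3) 𝓘(ℝ, ℝ) τ q (R q) = (1 : ℝ) := by
  obtain ⟨W, τ, hW, hpW, hWU, hτ, hτR⟩ := exists_transverse h hp
  obtain ⟨e, hpe, heW, -, heR⟩ := exists_chart_of_transverse h hW hpW hWU hτ hτR
  have hRs : ContDiffOn ℝ ∞ (push e R) (e.target ∩ e.symm ⁻¹' U) :=
    contDiffOn_push e h.reeb.isOpen h.reeb.smooth
  have hsub : ∀ x ∈ e.target, x ∈ e.target ∩ e.symm ⁻¹' U :=
    fun x hx => ⟨hx, hWU (heW (e.map_target hx))⟩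
  have hr : ContDiffOn ℝ ∞ (fun x => (push e R x).2) e.target :=
    contDiff_snd.comp_contDiffOn (hRs.mono hsub)
  have hpush : ∀ q ∈ e.source, push e R (e q) = (0, (push e R (e q)).2) := fun q hq => by
    rw [push_apply e R hq, heR q hq]
    rfl
  let O : Set (EuclideanSpace ℝ (Fin 2) × ℝ) := e.target ∩ (fun x => (push e R x).2) ⁻¹' {0}ᶜ
  have hO : IsOpen O :=
    hr.continuousOn.isOpen_inter_preimage e.open_target isOpen_compl_singleton
  have hpO : e p ∈ O := by
    refine ⟨e.map_source hpe, ?_⟩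
    change (push e R (e p)).2 ≠ 0
    rw [push_apply e R hpe, heR p hpe]
    exact hτR
  -- In these coordinates `R = r ∂_z` with `r ≠ 0` on `O`, so a primitive `w` of `1 / r` along `z`
  -- has derivative one along `R`.
  obtain ⟨w, hw, hwd⟩ := exists_primitive_snd hO hpO
    ((hr.mono inter_subset_left).inv fun x hx => hx.2)
  obtain ⟨O', hO'sub, hO', hpO'⟩ := eventually_nhds_iff.1 (hwd.and (hO.mem_nhds hpO))
  have hWO : IsOpen (e.source ∩ e ⁻¹' O') :=
    e.toOpenPartialHomeomorph.isOpen_inter_preimage hO'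
  refine ⟨e.source ∩ e ⁻¹' O', w ∘ e, hWO, ⟨hpe, hpO'⟩,
    fun q hq => hWU (heW hq.1), ?_, fun q hq => ?_⟩
  · exact hw.contMDiff.comp_contMDiffOn (e.contMDiffOn.mono inter_subset_left)
  · have hwq : HasMFDerivAt 𝓘(ℝ, EuclideanSpace ℝ (Fin 2) × ℝ) 𝓘(ℝ, ℝ) w (e q)
        (fderiv ℝ w (e q)) :=
      ((hw.differentiable (by simp)) (e q)).hasFDerivAt.hasMFDerivAt
    have hd := hwq.comp q (e.mdifferentiableAt (by simp) hq.1).hasMFDerivAt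
    rw [hd.mfderiv]
    have h1 := hO'sub (e q) hq.2
    have h2 : push e R (e q) = (push e R (e q)).2 • ((0, 1) : EuclideanSpace ℝ (Fin 2) × ℝ) := by
      conv_lhs => rw [hpush q hq.1]
      simp
    refine (congrArg (fderiv ℝ w (e q)) ((push_apply e R hq.1).symm.trans h2)).trans ?_
    rw [map_smul, h1.1, smul_eq_mul]
    exact mul_inv_cancel₀ h1.2.2

/-- The chart is cut down to a ball of the product norm, which is a base ball times an interval; a
function with zero `z`-derivative there is a function on the base ball. -/
theorem exists_flowBox (h : S.IsReebQuotient U R π) {p : M} (hp : p ∈ U) :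
    ∃ B : FlowBox U R π (π p), p ∈ B.e.source := by
  obtain ⟨W, τ, hW, hpW, hWU, hτ, hτR⟩ := exists_transverse_eq_one h hp
  obtain ⟨e, hpe, heW, hef, heR⟩ := exists_chart_of_transverse h hW hpW hWU hτ
    (by rw [hτR p hpW]; exact one_ne_zero (α := ℝ))
  obtain ⟨r, hr, hrt⟩ := Metric.isOpen_iff.1 e.open_target (e p) (e.map_source hpe)
  let e' := restrTarget e (Metric.ball (e p) r) Metric.isOpen_ball
  have hs : ∀ q, q ∈ e'.source ↔ q ∈ e.source ∧ e q ∈ Metric.ball (e p) r := fun q => Iff.rfl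
  have hee : ∀ q, e' q = e q := fun q => rfl
  refine ⟨⟨e', e p, r, hr, ?_, fun q hq => hWU (heW hq.1), fun q hq => (hef q hq.1).1,
    fun q hq => ?_, fun q hq => ?_⟩, hpe, Metric.mem_ball_self hr⟩
  · ext x
    constructor
    · exact fun hx => hx.1
    · exact fun hx => ⟨hx, hrt hx⟩
  · rw [hee, (hef q hq.1).2]
  · have : (e' : M → _) = e := funext hee
    rw [this, heR q hq.1, hτR q (heW hq.1)]
    rfl

end Reeb

/-! ### Planes transverse to the vertical line as graphs. -/

section LinearAlgebra

/-- The linear map from the plane sending the standard basis to `a`, `b`. -/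
def frameMap {V : Type*} [NormedAddCommGroup V] [NormedSpace ℝ V] (a b : V) :
    EuclideanSpace ℝ (Fin 2) →L[ℝ] V :=
  (EuclideanSpace.proj (0 : Fin 2) : EuclideanSpace ℝ (Fin 2) →L[ℝ] ℝ).smulRight a +
    (EuclideanSpace.proj (1 : Fin 2) : EuclideanSpace ℝ (Fin 2) →L[ℝ] ℝ).smulRight b

lemma frameMap_apply {V : Type*} [NormedAddCommGroup V] [NormedSpace ℝ V] (a b : V)
    (t : EuclideanSpace ℝ (Fin 2)) : frameMap a b t = t 0 • a + t 1 • b := rfl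

lemma contDiffOn_frameMap {V P : Type*} [NormedAddCommGroup V] [NormedSpace ℝ V]
    [NormedAddCommGroup P] [NormedSpace ℝ P] {a b : P → V} {s : Set P}
    (ha : ContDiffOn ℝ ∞ a s) (hb : ContDiffOn ℝ ∞ b s) :
    ContDiffOn ℝ ∞ (fun x => frameMap (a x) (b x)) s :=
  (contDiffOn_const.smulRight ha).add (contDiffOn_const.smulRight hb)

lemma exists_combination {V : Type*} [AddCommGroup V] [Module ℝ V] {D : Submodule ℝ V}
    (hD : Module.finrank ℝ D = 2) {u₁ u₂ : D} (hu : LinearIndependent ℝ ![u₁, u₂]) (u : D) :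
    ∃ s t : ℝ, u = s • u₁ + t • u₂ := by
  have := Module.finite_of_finrank_eq_succ hD
  have hspan := hu.span_eq_top_of_card_eq_finrank' (by simp [hD])
  have : u ∈ Submodule.span ℝ (range ![u₁, u₂]) := by rw [hspan]; trivial
  rw [Matrix.range_cons, Matrix.range_cons, Matrix.range_empty, union_empty,
    singleton_union] at this
  obtain ⟨s, t, h⟩ := Submodule.mem_span_pair.1 this
  exact ⟨s, t, h.symm⟩

variable {V : Type*} [AddCommGroup V] [Module ℝ V] {D : Submodule ℝ V}
  {T : V →ₗ[ℝ] EuclideanSpace ℝ (Fin 2) × ℝ} {R : V}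

/-- A combination of `u₁`, `u₂` whose base component vanishes is a multiple of `R`; lying in `D`,
which does not contain `R`, it is zero. -/
lemma isInvertible_frameMap (hT : Function.Injective T) (hR : T R = (0, 1)) (hRD : R ∉ D)
    {u₁ u₂ : D} (hu : LinearIndependent ℝ ![u₁, u₂]) :
    (frameMap (T u₁).1 (T u₂).1).IsInvertible := by
  have hinj : Function.Injective (frameMap (T u₁).1 (T u₂).1).toLinearMap := by
    rw [injective_iff_map_eq_zero]
    intro t ht
    have h1 : T ((t 0 • u₁ + t 1 • u₂ : D) - (T (t 0 • u₁ + t 1 • u₂ : D)).2 • R) = 0 := by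
      rw [map_sub, map_smul, hR]
      refine Prod.ext ?_ ?_
      · have : t 0 • (T u₁).1 + t 1 • (T u₂).1 = 0 := ht
        simpa using this
      · simp
    have h2 := hT (h1.trans (map_zero T).symm)
    rw [sub_eq_zero] at h2
    set c := (T (t 0 • u₁ + t 1 • u₂ : D)).2
    have hc : c = 0 := by
      by_contra hc
      refine hRD ?_
      have : R = c⁻¹ • ((t 0 • u₁ + t 1 • u₂ : D) : V) := by rw [h2, smul_smul, inv_mul_cancel₀ hc,
        one_smul]
      rw [this]
      exact D.smul_mem _ (Subtype.mem _)
    rw [hc, zero_smul] at h2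
    have h3 := LinearIndependent.pair_iff.1 hu (t 0) (t 1) (Subtype.ext h2)
    ext i
    fin_cases i
    · exact h3.1
    · exact h3.2
  let E := (LinearEquiv.ofInjectiveEndo _ hinj).toContinuousLinearEquiv
  exact ⟨E, by ext1 v; rfl⟩

/-- The image of `D` meets the vertical line only in zero, so it is the graph of a linear form on
the base. Writing this form through a basis of `D` shows that it varies smoothly with a smooth
frame. -/
lemma mem_iff_graph (hT : Function.Injective T) (hR : T R = (0, 1)) (hRD : R ∉ D)
    (hD : Module.finrank ℝ D = 2) {u₁ u₂ : D} (hu : LinearIndependent ℝ ![u₁, u₂]) (u : V) :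
    u ∈ D ↔ (T u).2 = (frameMap (T u₁).2 (T u₂).2)
      ((frameMap (T u₁).1 (T u₂).1).inverse (T u).1) := by
  have hL := isInvertible_frameMap hT hR hRD hu
  constructor
  · intro h
    obtain ⟨s, t, hst⟩ := exists_combination hD hu ⟨u, h⟩
    have hu' : u = s • (u₁ : V) + t • (u₂ : V) := congrArg Subtype.val hst
    have h1 : (T u).1 = frameMap (T u₁).1 (T u₂).1 !₂[s, t] := by
      rw [hu', frameMap_apply]; simp
    rw [h1, hL.inverse_apply_self, hu', frameMap_apply]
    simp
  · intro h
    set w := (frameMap (T u₁).1 (T u₂).1).inverse (T u).1 with hw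
    have h1 : (T u).1 = frameMap (T u₁).1 (T u₂).1 w := (hL.self_apply_inverse _).symm
    have h2 : u = w 0 • (u₁ : V) + w 1 • (u₂ : V) := by
      apply hT
      refine Prod.ext ?_ ?_
      · rw [h1, frameMap_apply]; simp
      · rw [h, frameMap_apply]; simp
    rw [h2]
    exact D.add_mem (D.smul_mem _ u₁.2) (D.smul_mem _ u₂.2)

end LinearAlgebra

/-! ### Brackets of vector fields tangent to a graph. -/

section Calculus

variable {P : Type*} [NormedAddCommGroup P] [NormedSpace ℝ P]
  {A : P × ℝ → P →L[ℝ] ℝ} {Z₁ Z₂ : P × ℝ → P × ℝ} {x : P × ℝ}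

/-- The product rule for the graph equation. In the bracket formulas below the last term cancels
against `A` applied to the base component. -/
lemma fderiv_snd_of_graph (hA : DifferentiableAt ℝ A x) (hZ : DifferentiableAt ℝ Z₁ x)
    (h : ∀ᶠ y in 𝓝 x, (Z₁ y).2 = A y (Z₁ y).1) (v : P × ℝ) :
    (fderiv ℝ Z₁ x v).2 = fderiv ℝ A x v (Z₁ x).1 + A x (fderiv ℝ Z₁ x v).1 := by
  have h1 : HasFDerivAt (fun y => (Z₁ y).2) ((ContinuousLinearMap.snd ℝ P ℝ).comp (fderiv ℝ Z₁ x)) x :=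
    hZ.hasFDerivAt.snd
  have h2 := hA.hasFDerivAt.clm_apply (hZ.hasFDerivAt.fst)
  have h3 := h1.unique (h2.congr_of_eventuallyEq h)
  have := congrArg (fun L : P × ℝ →L[ℝ] ℝ => L v) h3
  simp at this
  rw [this]; ring

/-- The vertical part of the bracket of two fields tangent to the graph of `A`. -/
lemma lieBracket_of_graph (hA : DifferentiableAt ℝ A x) (hZ₁ : DifferentiableAt ℝ Z₁ x)
    (hZ₂ : DifferentiableAt ℝ Z₂ x) (h₁ : ∀ᶠ y in 𝓝 x, (Z₁ y).2 = A y (Z₁ y).1)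
    (h₂ : ∀ᶠ y in 𝓝 x, (Z₂ y).2 = A y (Z₂ y).1) :
    (lieBracket ℝ Z₁ Z₂ x).2 - A x (lieBracket ℝ Z₁ Z₂ x).1 =
      fderiv ℝ A x (Z₁ x) (Z₂ x).1 - fderiv ℝ A x (Z₂ x) (Z₁ x).1 := by
  rw [lieBracket]
  simp only [Prod.snd_sub, Prod.fst_sub, map_sub]
  rw [fderiv_snd_of_graph hA hZ₁ h₁, fderiv_snd_of_graph hA hZ₂ h₂]
  ring

/-- A locally constant field has zero derivative, so only the derivative of `A` along `z` survives
as the obstruction to the bracket being tangent to the graph. -/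
lemma lieBracket_const_of_graph (hA : DifferentiableAt ℝ A x) (hZ₂ : DifferentiableAt ℝ Z₂ x)
    (h₁ : ∀ᶠ y in 𝓝 x, Z₁ y = (0, 1)) (h₂ : ∀ᶠ y in 𝓝 x, (Z₂ y).2 = A y (Z₂ y).1) :
    (lieBracket ℝ Z₁ Z₂ x).2 - A x (lieBracket ℝ Z₁ Z₂ x).1 =
      fderiv ℝ A x (0, 1) (Z₂ x).1 := by
  have h : fderiv ℝ Z₁ x = 0 := by
    rw [Filter.EventuallyEq.fderiv_eq (f := fun _ => ((0, 1) : P × ℝ)) h₁]; simp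
  rw [lieBracket, h, h₁.self_of_nhds]
  simp only [zero_apply, sub_zero]
  rw [fderiv_snd_of_graph hA hZ₂ h₂]
  ring

/-- In the product norm the vertical slices of a ball are intervals through the height of the
centre. -/
lemma eq_of_fderiv_snd_eq_zero {G : Type*} [NormedAddCommGroup G] [NormedSpace ℝ G]
    {f : P × ℝ → G} {c : P × ℝ} {r : ℝ} (hf : DifferentiableOn ℝ f (Metric.ball c r))
    (h0 : ∀ x ∈ Metric.ball c r, fderiv ℝ f x (0, 1) = 0) {x : P × ℝ}
    (hx : x ∈ Metric.ball c r) : f x = f (x.1, c.2) := by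
  have hball : ∀ t ∈ Metric.ball c.2 r, (x.1, t) ∈ Metric.ball c r := fun t ht => by
    rw [← ball_prod_same] at hx ⊢
    exact ⟨hx.1, ht⟩
  have hx2 : x.2 ∈ Metric.ball c.2 r := by
    rw [← ball_prod_same] at hx; exact hx.2
  have hd : ∀ t ∈ Metric.ball c.2 r, HasDerivAt (fun t => f (x.1, t)) 0 t := fun t ht => by
    have h1 := ((hf _ (hball t ht)).differentiableAt
      (Metric.isOpen_ball.mem_nhds (hball t ht))).hasFDerivAt
    have h2 : HasDerivAt (fun s : ℝ => ((x.1, s) : P × ℝ)) (0, 1) t :=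
      (hasDerivAt_const _ _).prodMk (hasDerivAt_id _)
    have h3 := h1.comp_hasDerivAt (f := fun s : ℝ => ((x.1, s) : P × ℝ)) t h2
    rwa [h0 _ (hball t ht)] at h3
  exact Metric.isOpen_ball.is_const_of_deriv_eq_zero (convex_ball _ _).isPreconnected
    (fun t ht => (hd t ht).differentiableAt.differentiableWithinAt)
    (fun t ht => (hd t ht).deriv) hx2 (Metric.mem_ball_self (Metric.pos_of_mem_ball hx))

end Calculus

/-! ### The contact distribution and its metric in a flow box. -/

section ReebQuotient

variable {M : Type*} [TopologicalSpace M]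
  [ChartedSpace (EuclideanSpace ℝ (Fin 3)) M] [IsManifold (𝓡 3) ∞ M]
  {N : Type*} [TopologicalSpace N]
  [ChartedSpace (EuclideanSpace ℝ (Fin 2)) N] [IsManifold (𝓡 2) ∞ N]
  {S : ContactStructure M} {U : Set M} {R : ∀ p : M, TangentSpace (𝓡 3) p} {π : M → N} {y₀ : N}

namespace FlowBox

variable (B : FlowBox U R π y₀)

/-- The differential of the chart. -/
def d (q : M) : TangentSpace (𝓡 3) q →ₗ[ℝ] EuclideanSpace ℝ (Fin 2) × ℝ :=
  (mfderiv (𝓡 3) 𝓘(ℝ, EuclideanSpace ℝ (Fin 2) × ℝ) B.e q).toLinearMap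

variable {B}

lemma d_injective {q : M} (hq : q ∈ B.e.source) : Function.Injective (B.d q) :=
  (isInvertible_mfderiv_partialDiffeomorph B.e hq).injective

lemma d_surjective {q : M} (hq : q ∈ B.e.source) : Function.Surjective (B.d q) :=
  (isInvertible_mfderiv_partialDiffeomorph B.e hq).surjective

lemma d_reeb {q : M} (hq : q ∈ B.e.source) : B.d q (R q) = (0, 1) := B.reeb q hq

lemma push_eq (X : ∀ p : M, TangentSpace (𝓡 3) p) {q : M} (hq : q ∈ B.e.source) :
    push B.e X (B.e q) = B.d q (X q) := push_apply B.e X hq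

lemma d_pull (Z : EuclideanSpace ℝ (Fin 2) × ℝ → EuclideanSpace ℝ (Fin 2) × ℝ) {q : M}
    (hq : q ∈ B.e.source) : B.d q (pull B.e Z q) = Z (B.e q) := mfderiv_pull B.e Z hq

lemma d_mlieBracket {X Y : ∀ p : M, TangentSpace (𝓡 3) p} {W : Set M} (hW : IsOpen W)
    (hX : SmoothVF X W) (hY : SmoothVF Y W) {q : M} (hq : q ∈ B.e.source) (hqW : q ∈ W) :
    B.d q (mlieBracket (𝓡 3) X Y q) = lieBracket ℝ (push B.e X) (push B.e Y) (B.e q) :=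
  mfderiv_mlieBracket B.e hW hX hY hq hqW

variable (B) in
/-- The contact distribution in a flow box is the graph of a smooth field of `1`-forms. -/
lemma exists_graph (h : S.IsReebQuotient U R π) :
    ∃ A : EuclideanSpace ℝ (Fin 2) × ℝ → EuclideanSpace ℝ (Fin 2) →L[ℝ] ℝ,
      ContDiffOn ℝ ∞ A B.e.target ∧
      ∀ q ∈ B.e.source, ∀ u, u ∈ S.D q ↔ (B.d q u).2 = A (B.e q) (B.d q u).1 := by
  have hloc : ∀ p ∈ B.e.source, ∃ O : Set (EuclideanSpace ℝ (Fin 2) × ℝ), IsOpen O ∧ B.e p ∈ O ∧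
      O ⊆ B.e.target ∧
      ∃ A : EuclideanSpace ℝ (Fin 2) × ℝ → EuclideanSpace ℝ (Fin 2) →L[ℝ] ℝ,
      ContDiffOn ℝ ∞ A O ∧
      ∀ q ∈ B.e.source, B.e q ∈ O → ∀ u, u ∈ S.D q ↔ (B.d q u).2 = A (B.e q) (B.d q u).1 := by
    intro p hp
    obtain ⟨W, hW, hpW, X, Y, hX, hY, hli⟩ := S.smooth_D p
    let X' := push B.e (S.vf X)
    let Y' := push B.e (S.vf Y)
    have hX' : ContDiffOn ℝ ∞ X' (B.e.target ∩ B.e.symm ⁻¹' W) := contDiffOn_push B.e hW hX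
    have hY' : ContDiffOn ℝ ∞ Y' (B.e.target ∩ B.e.symm ⁻¹' W) := contDiffOn_push B.e hW hY
    have hO : IsOpen (B.e.target ∩ B.e.symm ⁻¹' W) :=
      B.e.symm.toOpenPartialHomeomorph.isOpen_inter_preimage hW
    have hqW : ∀ q ∈ B.e.source, B.e q ∈ B.e.target ∩ B.e.symm ⁻¹' W → q ∈ W := fun q hq h => by
      have := h.2
      rwa [mem_preimage, symm_apply_apply B.e hq] at this
    have hinv : ∀ q ∈ B.e.source, q ∈ W →
        (frameMap (X' (B.e q)).1 (Y' (B.e q)).1).IsInvertible := fun q hq hqW => by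
      have := isInvertible_frameMap (d_injective hq) (d_reeb hq)
        (h.reeb.notMem (B.source_subset hq)) (hli q hqW)
      rwa [← push_eq (fun q => (X q : TangentSpace (𝓡 3) q)) hq,
        ← push_eq (fun q => (Y q : TangentSpace (𝓡 3) q)) hq] at this
    refine ⟨B.e.target ∩ B.e.symm ⁻¹' W, hO, ⟨B.e.map_source hp, by
      rwa [mem_preimage, symm_apply_apply B.e hp]⟩, inter_subset_left,
      fun x => (frameMap (X' x).2 (Y' x).2).comp (frameMap (X' x).1 (Y' x).1).inverse, ?_, ?_⟩
    · intro x hx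
      have hxs : B.e.symm x ∈ B.e.source := B.e.map_target hx.1
      have hx' : B.e (B.e.symm x) = x := B.e.right_inv hx.1
      obtain ⟨L, hL⟩ := hinv _ hxs hx.2
      rw [hx'] at hL
      have h1 : ContDiffOn ℝ ∞ (fun x => frameMap (X' x).1 (Y' x).1)
          (B.e.target ∩ B.e.symm ⁻¹' W) := contDiffOn_frameMap hX'.fst hY'.fst
      have h2 : ContDiffOn ℝ ∞ (fun x => frameMap (X' x).2 (Y' x).2)
          (B.e.target ∩ B.e.symm ⁻¹' W) := contDiffOn_frameMap hX'.snd hY'.snd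
      refine (h2 x hx).clm_comp ?_
      have h3 : ContDiffAt ℝ ∞ ContinuousLinearMap.inverse (frameMap (X' x).1 (Y' x).1) := by
        rw [← hL]; exact contDiffAt_map_inverse L
      exact h3.comp_contDiffWithinAt x (h1 x hx)
    · intro q hq hqO u
      have := mem_iff_graph (d_injective hq) (d_reeb hq)
        (h.reeb.notMem (B.source_subset hq)) (S.finrank_D q) (hli q (hqW q hq hqO)) u
      rwa [← push_eq (fun q => (X q : TangentSpace (𝓡 3) q)) hq,
        ← push_eq (fun q => (Y q : TangentSpace (𝓡 3) q)) hq] at this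
  choose! O hO hpO hOt A hA hAD using hloc
  -- At `x` the local form attached to the point over `x` is used. Local forms agree on overlaps
  -- because a graph determines its linear form, so the result is smooth.
  refine ⟨fun x => A (B.e.symm x) x, fun x hx => ?_, fun q hq u => ?_⟩
  · have hxs : B.e.symm x ∈ B.e.source := B.e.map_target hx
    have hx' : B.e (B.e.symm x) = x := B.e.right_inv hx
    have hxO : x ∈ O (B.e.symm x) := by
      have := hpO _ hxs; rwa [hx'] at this
    refine ((((hA _ hxs).contDiffAt ((hO _ hxs).mem_nhds hxO))).congr_of_eventuallyEq
      ?_).contDiffWithinAt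
    filter_upwards [(hO _ hxs).mem_nhds hxO] with y hy
    have hyt := hOt _ hxs hy
    have hys : B.e.symm y ∈ B.e.source := B.e.map_target hyt
    have hy' : B.e (B.e.symm y) = y := B.e.right_inv hyt
    ext v
    obtain ⟨u, hu⟩ := d_surjective hys (v, A (B.e.symm x) y v)
    have hu1 : (B.d _ u).1 = v := congrArg Prod.fst hu
    have hu2 : (B.d _ u).2 = A (B.e.symm x) y v := congrArg Prod.snd hu
    have h1 := (hAD _ hxs _ hys (by rwa [hy']) u).2 (by rw [hu2, hu1, hy'])
    have h2 := (hAD _ hys _ hys (hpO _ hys) u).1 h1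
    rw [hu1, hu2, hy'] at h2
    exact h2.symm
  · have := hAD q hq q hq (hpO q hq) u
    simpa only [symm_apply_apply B.e hq] using this

end FlowBox

/-- The field of `1`-forms in a flow box whose graph is the contact distribution. -/
structure GraphForm (S : ContactStructure M) (B : FlowBox U R π y₀) where
  /-- the field of `1`-forms -/
  A : EuclideanSpace ℝ (Fin 2) × ℝ → EuclideanSpace ℝ (Fin 2) →L[ℝ] ℝ
  smooth : ContDiffOn ℝ ∞ A B.e.target
  mem_iff : ∀ q ∈ B.e.source, ∀ u, u ∈ S.D q ↔ (B.d q u).2 = A (B.e q) (B.d q u).1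

namespace GraphForm

variable {B : FlowBox U R π y₀} (F : GraphForm S B)

lemma target_mem_nhds {q : M} (hq : q ∈ B.e.source) : B.e.target ∈ 𝓝 (B.e q) :=
  B.e.open_target.mem_nhds (B.e.map_source hq)

lemma differentiableAt {q : M} (hq : q ∈ B.e.source) : DifferentiableAt ℝ F.A (B.e q) :=
  (F.smooth.contDiffAt (target_mem_nhds hq)).differentiableAt (by simp)

lemma push_graph (X : ∀ q, S.D q) {x : EuclideanSpace ℝ (Fin 2) × ℝ} (hx : x ∈ B.e.target) :
    (push B.e (S.vf X) x).2 = F.A x (push B.e (S.vf X) x).1 := by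
  have hxs : B.e.symm x ∈ B.e.source := B.e.map_target hx
  have hx' : B.e (B.e.symm x) = x := B.e.right_inv hx
  have h1 := (F.mem_iff _ hxs (S.vf X (B.e.symm x))).1 (X _).2
  rw [← FlowBox.push_eq (S.vf X) hxs, hx'] at h1
  exact h1

lemma push_reeb {x : EuclideanSpace ℝ (Fin 2) × ℝ} (hx : x ∈ B.e.target) :
    push B.e R x = (0, 1) := by
  have hxs : B.e.symm x ∈ B.e.source := B.e.map_target hx
  have hx' : B.e (B.e.symm x) = x := B.e.right_inv hx
  rw [← hx', FlowBox.push_eq R hxs, FlowBox.d_reeb hxs]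

lemma differentiableAt_push {X : ∀ p : M, TangentSpace (𝓡 3) p} {W : Set M} (hW : IsOpen W)
    (hX : SmoothVF X W) {q : M} (hq : q ∈ B.e.source) (hqW : q ∈ W) :
    DifferentiableAt ℝ (push B.e X) (B.e q) := by
  have hO : IsOpen (B.e.target ∩ B.e.symm ⁻¹' W) :=
    B.e.symm.toOpenPartialHomeomorph.isOpen_inter_preimage hW
  refine ((contDiffOn_push B.e hW hX).contDiffAt (hO.mem_nhds ⟨B.e.map_source hq, ?_⟩))
    |>.differentiableAt (by simp)
  rwa [mem_preimage, symm_apply_apply B.e hq]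

/-- The defining properties of the Reeb field in a flow box. -/
lemma exists_frame (h : S.IsReebQuotient U R π) {q : M} (hq : q ∈ B.e.source) :
    ∃ X₁ X₂ : S.D q, (S.g q X₁ X₁ = 1 ∨ S.g q X₁ X₁ = -1) ∧ S.g q X₂ X₂ = 1 ∧ S.g q X₁ X₂ = 0 ∧
      LinearIndependent ℝ ![X₁, X₂] ∧
      fderiv ℝ F.A (B.e q) (0, 1) (B.d q X₁).1 = 0 ∧
      fderiv ℝ F.A (B.e q) (0, 1) (B.d q X₂).1 = 0 ∧
      fderiv ℝ F.A (B.e q) (B.d q X₁) (B.d q X₂).1 -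
        fderiv ℝ F.A (B.e q) (B.d q X₂) (B.d q X₁).1 = 1 := by
  obtain ⟨W, hW, hqW, hWU, X₁, X₂, hX, hbr⟩ := h.reeb.frame q (B.source_subset hq)
  have hRs : SmoothVF R W := h.reeb.smooth.mono hWU
  have hev : ∀ᶠ x in 𝓝 (B.e q), x ∈ B.e.target := target_mem_nhds hq
  have hR : ∀ᶠ x in 𝓝 (B.e q), push B.e R x = (0, 1) := hev.mono fun x hx => push_reeb hx
  have hgr : ∀ X : ∀ q, S.D q, ∀ᶠ x in 𝓝 (B.e q),
      (push B.e (S.vf X) x).2 = F.A x (push B.e (S.vf X) x).1 := fun X =>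
    hev.mono fun x hx => F.push_graph X hx
  obtain ⟨h1, h2, h3⟩ := hbr q hqW
  have hd := F.differentiableAt hq
  have hd1 := differentiableAt_push hW hX.smooth_fst hq hqW
  have hd2 := differentiableAt_push hW hX.smooth_snd hq hqW
  have e1 : push B.e (S.vf X₁) (B.e q) = B.d q (X₁ q) := FlowBox.push_eq _ hq
  have e2 : push B.e (S.vf X₂) (B.e q) = B.d q (X₂ q) := FlowBox.push_eq _ hq
  rw [F.mem_iff q hq, FlowBox.d_mlieBracket hW hRs hX.smooth_fst hq hqW, ← sub_eq_zero,
    lieBracket_const_of_graph hd hd1 hR (hgr X₁), e1] at h1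
  rw [F.mem_iff q hq, FlowBox.d_mlieBracket hW hRs hX.smooth_snd hq hqW, ← sub_eq_zero,
    lieBracket_const_of_graph hd hd2 hR (hgr X₂), e2] at h2
  rw [F.mem_iff q hq, map_sub, FlowBox.d_mlieBracket hW hX.smooth_fst hX.smooth_snd hq hqW,
    FlowBox.d_reeb hq, ← sub_eq_zero] at h3
  have h4 := lieBracket_of_graph hd hd1 hd2 (hgr X₁) (hgr X₂)
  rw [e1, e2] at h4
  simp only [Prod.snd_sub, Prod.fst_sub, sub_zero] at h3
  refine ⟨X₁ q, X₂ q, hX.fst_fst q hqW, hX.snd_snd q hqW, hX.fst_snd q hqW,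
    hX.linearIndependent hqW, h1, h2, ?_⟩
  rw [← h4]
  linarith

/-- By `[R, Xᵢ] ∈ D` the derivative of `A` along `z` kills the base components of the frame, and
these span the plane since `D` is transverse to `R`. -/
lemma fderiv_reeb (h : S.IsReebQuotient U R π) {x : EuclideanSpace ℝ (Fin 2) × ℝ}
    (hx : x ∈ B.e.target) : fderiv ℝ F.A x (0, 1) = 0 := by
  have hxs : B.e.symm x ∈ B.e.source := B.e.map_target hx
  have hx' : B.e (B.e.symm x) = x := B.e.right_inv hx
  obtain ⟨X₁, X₂, -, -, -, hli, h1, h2, -⟩ := F.exists_frame h hxs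
  rw [hx'] at h1 h2
  have hL := isInvertible_frameMap (FlowBox.d_injective hxs) (FlowBox.d_reeb hxs)
    (h.reeb.notMem (B.source_subset hxs)) hli
  ext v
  rw [← hL.self_apply_inverse v, frameMap_apply, map_add, map_smul, map_smul, h1, h2]
  simp

/-- The `1`-form on the base of the flow box. -/
def base (y : EuclideanSpace ℝ (Fin 2)) : EuclideanSpace ℝ (Fin 2) →L[ℝ] ℝ := F.A (y, B.c.2)

lemma mem_target_of_mem_ball {y : EuclideanSpace ℝ (Fin 2)} (hy : y ∈ Metric.ball B.c.1 B.r) :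
    (y, B.c.2) ∈ B.e.target := by
  rw [B.target_eq, ← ball_prod_same]
  exact ⟨hy, Metric.mem_ball_self B.r_pos⟩

lemma fst_mem_ball {x : EuclideanSpace ℝ (Fin 2) × ℝ} (hx : x ∈ B.e.target) :
    x.1 ∈ Metric.ball B.c.1 B.r := by
  rw [B.target_eq, ← ball_prod_same] at hx
  exact hx.1

lemma contDiffOn_slice {G : Type*} [NormedAddCommGroup G] [NormedSpace ℝ G]
    {f : EuclideanSpace ℝ (Fin 2) × ℝ → G} (hf : ContDiffOn ℝ ∞ f B.e.target) :
    ContDiffOn ℝ ∞ (fun y => f (y, B.c.2)) (Metric.ball B.c.1 B.r) :=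
  hf.comp (contDiff_id.prodMk contDiff_const).contDiffOn fun _ hy => mem_target_of_mem_ball hy

lemma A_eq_base (h : S.IsReebQuotient U R π) {x : EuclideanSpace ℝ (Fin 2) × ℝ}
    (hx : x ∈ B.e.target) : F.A x = F.base x.1 := by
  have hd := F.smooth.differentiableOn (by simp)
  have h0 := fun x hx => F.fderiv_reeb (x := x) h hx
  rw [B.target_eq] at hx hd h0
  exact eq_of_fderiv_snd_eq_zero hd h0 hx

lemma fderiv_A (h : S.IsReebQuotient U R π) {x : EuclideanSpace ℝ (Fin 2) × ℝ}
    (hx : x ∈ B.e.target) (v : EuclideanSpace ℝ (Fin 2) × ℝ) :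
    fderiv ℝ F.A x v = fderiv ℝ F.base x.1 v.1 := by
  have h1 : F.A =ᶠ[𝓝 x] F.base ∘ Prod.fst := by
    filter_upwards [B.e.open_target.mem_nhds hx] with y hy using F.A_eq_base h hy
  have h2 : DifferentiableAt ℝ F.base x.1 :=
    ((contDiffOn_slice F.smooth).contDiffAt (Metric.isOpen_ball.mem_nhds
      (fst_mem_ball hx))).differentiableAt (by simp)
  rw [h1.fderiv_eq, fderiv_comp x h2 differentiableAt_fst, fderiv_fst]
  rfl

open Classical in
/-- The lift of a constant vector field on the base to a section of the contact distribution. -/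
def lift (q : M) : EuclideanSpace ℝ (Fin 2) →ₗ[ℝ] S.D q :=
  if hq : q ∈ B.e.source then
    LinearMap.codRestrict (S.D q)
      ((mfderiv (𝓡 3) 𝓘(ℝ, EuclideanSpace ℝ (Fin 2) × ℝ) B.e q).inverse.toLinearMap ∘ₗ
        LinearMap.prod LinearMap.id (F.A (B.e q)).toLinearMap)
      (fun v => by
        have h1 : B.d q _ = (v, F.A (B.e q) v) := FlowBox.d_pull (fun x => (v, F.A x v)) hq
        refine (F.mem_iff q hq (pull B.e (fun x => (v, F.A x v)) q)).2 ?_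
        rw [h1])
  else 0

lemma lift_eq_pull {q : M} (hq : q ∈ B.e.source) (v : EuclideanSpace ℝ (Fin 2)) :
    (F.lift q v : TangentSpace (𝓡 3) q) = pull B.e (fun x => (v, F.A x v)) q := by
  rw [lift, dif_pos hq]
  rfl

lemma d_lift {q : M} (hq : q ∈ B.e.source) (v : EuclideanSpace ℝ (Fin 2)) :
    B.d q (F.lift q v) = (v, F.A (B.e q) v) := by
  rw [lift_eq_pull F hq, FlowBox.d_pull _ hq]

lemma lift_fst {q : M} (hq : q ∈ B.e.source) (u : S.D q) : F.lift q (B.d q u).1 = u := by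
  apply Subtype.ext
  apply FlowBox.d_injective hq
  rw [F.d_lift hq]
  exact Prod.ext rfl ((F.mem_iff q hq u).1 u.2).symm

lemma smooth_lift (v : EuclideanSpace ℝ (Fin 2)) :
    SmoothVF (S.vf fun q => F.lift q v) B.e.source := by
  have h1 := smoothVF_pull B.e B.e.open_target (Z := fun x => (v, F.A x v))
    (contDiffOn_const.prodMk (F.smooth.clm_apply contDiffOn_const))
  have h2 : B.e.source ∩ B.e ⁻¹' B.e.target = B.e.source :=
    inter_eq_left.2 fun q hq => B.e.map_source hq
  rw [h2] at h1
  refine ContMDiffOn.congr h1 fun q hq => ?_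
  exact congrArg (fun w => (⟨q, w⟩ : TangentBundle (𝓡 3) M)) (F.lift_eq_pull hq v)

/-- In the chart the lift is `(v, A v)`, whose coefficients do not depend on `z`, and `R` is `∂_z`.
-/
lemma mlieBracket_reeb_lift (h : S.IsReebQuotient U R π) {q : M} (hq : q ∈ B.e.source)
    (v : EuclideanSpace ℝ (Fin 2)) :
    mlieBracket (𝓡 3) R (S.vf fun q => F.lift q v) q = 0 := by
  apply FlowBox.d_injective hq
  rw [map_zero, FlowBox.d_mlieBracket B.e.open_source (h.reeb.smooth.mono B.source_subset)
    (F.smooth_lift v) hq hq]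
  have h1 : push B.e R =ᶠ[𝓝 (B.e q)] fun _ => (0, 1) :=
    eventually_of_mem (target_mem_nhds hq) fun x hx => push_reeb hx
  have h2 : push B.e (S.vf fun q => F.lift q v) =ᶠ[𝓝 (B.e q)] fun x => (v, F.A x v) := by
    filter_upwards [target_mem_nhds hq] with x hx
    have hxs : B.e.symm x ∈ B.e.source := B.e.map_target hx
    have hx' : B.e (B.e.symm x) = x := B.e.right_inv hx
    rw [← hx', FlowBox.push_eq _ hxs]
    exact F.d_lift hxs v
  have hA := (F.differentiableAt hq).hasFDerivAt
  have h3 : HasFDerivAt (fun x => (v, F.A x v))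
      ((0 : EuclideanSpace ℝ (Fin 2) × ℝ →L[ℝ] EuclideanSpace ℝ (Fin 2)).prod
        ((fderiv ℝ F.A (B.e q)).flip v)) (B.e q) := by
    refine (hasFDerivAt_const v _).prodMk ?_
    simpa using hA.clm_apply (hasFDerivAt_const v _)
  rw [lieBracket, h1.fderiv_eq, h2.fderiv_eq, h3.fderiv, h1.self_of_nhds]
  refine Prod.ext ?_ ?_
  · simp
  · simp [F.fderiv_reeb h (B.e.map_source hq)]

/-- The metric in the flow box. -/
def metric (x : EuclideanSpace ℝ (Fin 2) × ℝ) : LinearMap.BilinForm ℝ (EuclideanSpace ℝ (Fin 2)) :=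
  (S.g (B.e.symm x)).compl₁₂ (F.lift (B.e.symm x)) (F.lift (B.e.symm x))

lemma metric_apply (x : EuclideanSpace ℝ (Fin 2) × ℝ) (v w : EuclideanSpace ℝ (Fin 2)) :
    F.metric x v w = S.g (B.e.symm x) (F.lift _ v) (F.lift _ w) := rfl

lemma contDiffOn_metric (v w : EuclideanSpace ℝ (Fin 2)) :
    ContDiffOn ℝ ∞ (fun x => F.metric x v w) B.e.target := by
  rw [← contMDiffOn_iff_contDiffOn]
  exact (S.smooth_g B.e.source B.e.open_source (fun q => F.lift q v) (fun q => F.lift q w)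
    (F.smooth_lift v) (F.smooth_lift w)).comp B.e.symm.contMDiffOn fun x hx => B.e.map_target hx

lemma g_eq_metric {q : M} (hq : q ∈ B.e.source) (u v : S.D q) :
    S.g q u v = F.metric (B.e q) (B.d q u).1 (B.d q v).1 := by
  rw [metric_apply, symm_apply_apply B.e hq, F.lift_fst hq, F.lift_fst hq]

/-- On lifts of constant fields the bracket terms of `h` vanish, leaving half the derivative of the
coefficient along `R`. This is where `h = 0` enters. -/
lemma fderiv_metric_reeb (h : S.IsReebQuotient U R π) (hS : S.HVanishes)
    (v w : EuclideanSpace ℝ (Fin 2)) {x : EuclideanSpace ℝ (Fin 2) × ℝ} (hx : x ∈ B.e.target) :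
    fderiv ℝ (fun x => F.metric x v w) x (0, 1) = 0 := by
  have hxs : B.e.symm x ∈ B.e.source := B.e.map_target hx
  have hx' : B.e (B.e.symm x) = x := B.e.right_inv hx
  set q := B.e.symm x with hq
  have hv : mlieBracket (𝓡 3) R (S.vf fun q => F.lift q v) q ∈ S.D q := by
    rw [F.mlieBracket_reeb_lift h hxs]; exact (S.D q).zero_mem
  have hw : mlieBracket (𝓡 3) R (S.vf fun q => F.lift q w) q ∈ S.D q := by
    rw [F.mlieBracket_reeb_lift h hxs]; exact (S.D q).zero_mem
  have h1 := hS U R h.reeb B.e.source B.e.open_source B.source_subset _ _ (F.smooth_lift v)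
    (F.smooth_lift w) q hxs hv hw
  have zv : (⟨_, hv⟩ : S.D q) = 0 := Subtype.ext (F.mlieBracket_reeb_lift h hxs v)
  have zw : (⟨_, hw⟩ : S.D q) = 0 := Subtype.ext (F.mlieBracket_reeb_lift h hxs w)
  rw [ContactStructure.h, zv, zw, map_zero, map_zero] at h1
  have h2 : dirDeriv (fun q => S.g q (F.lift q v) (F.lift q w)) q (R q) = 0 := by
    simpa using h1
  have h3 : (fun q => S.g q (F.lift q v) (F.lift q w)) =ᶠ[𝓝 q]
      (fun x => F.metric x v w) ∘ B.e := by
    filter_upwards [B.e.open_source.mem_nhds hxs] with p hp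
    simp only [Function.comp, metric_apply]
    rw [symm_apply_apply B.e hp]
  have h4 : HasMFDerivAt 𝓘(ℝ, EuclideanSpace ℝ (Fin 2) × ℝ) 𝓘(ℝ, ℝ) (fun x => F.metric x v w)
      (B.e q) (fderiv ℝ (fun x => F.metric x v w) (B.e q)) :=
    (((F.contDiffOn_metric v w).contDiffAt (target_mem_nhds hxs)).differentiableAt
      (by simp)).hasFDerivAt.hasMFDerivAt
  have h5 := h4.comp q (B.e.mdifferentiableAt (by simp) hxs).hasMFDerivAt
  rw [dirDeriv, h3.mfderiv_eq, h5.mfderiv] at h2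
  have h6 : fderiv ℝ (fun x => F.metric x v w) (B.e q) (B.d q (R q)) = 0 := h2
  rwa [FlowBox.d_reeb hxs, hx'] at h6

lemma metric_eq (h : S.IsReebQuotient U R π) (hS : S.HVanishes)
    {x : EuclideanSpace ℝ (Fin 2) × ℝ} (hx : x ∈ B.e.target) :
    F.metric x = F.metric (x.1, B.c.2) := by
  ext v w
  have hd := (F.contDiffOn_metric v w).differentiableOn (by simp)
  have h0 := fun x hx => F.fderiv_metric_reeb (x := x) h hS v w hx
  rw [B.target_eq] at hx hd h0
  exact eq_of_fderiv_snd_eq_zero hd h0 hx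

end GraphForm

/-! ### The normal form: a 1-form and a metric on the base. -/

/-- The normal form of a contact structure with `h = 0` in a flow box: a `1`-form and a metric on
the base, whose area form is up to sign the differential of the `1`-form. -/
structure NormalForm (S : ContactStructure M) (B : FlowBox U R π y₀) where
  /-- the `1`-form -/
  a : EuclideanSpace ℝ (Fin 2) → EuclideanSpace ℝ (Fin 2) →L[ℝ] ℝ
  /-- the metric -/
  G : EuclideanSpace ℝ (Fin 2) → LinearMap.BilinForm ℝ (EuclideanSpace ℝ (Fin 2))
  contDiffOn_a : ContDiffOn ℝ ∞ a (Metric.ball B.c.1 B.r)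
  contDiffOn_G : ∀ v w, ContDiffOn ℝ ∞ (fun y => G y v w) (Metric.ball B.c.1 B.r)
  mem_iff : ∀ q ∈ B.e.source, ∀ u, u ∈ S.D q ↔ (B.d q u).2 = a (B.e q).1 (B.d q u).1
  g_eq : ∀ q ∈ B.e.source, ∀ u v : S.D q, S.g q u v = G (B.e q).1 (B.d q u).1 (B.d q v).1
  symm : ∀ y v w, G y v w = G y w v
  frame : ∀ y ∈ Metric.ball B.c.1 B.r, ∃ v₁ v₂, (G y v₁ v₁ = 1 ∨ G y v₁ v₁ = -1) ∧
    G y v₂ v₂ = 1 ∧ G y v₁ v₂ = 0 ∧ fderiv ℝ a y v₁ v₂ - fderiv ℝ a y v₂ v₁ = 1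

/-- Both the 1-form and the metric are independent of `z`, so nothing is lost by restricting them to
the slice at the height of the centre. The frame condition is `[X₁, X₂] ≡ R mod D`. -/
theorem nonempty_normalForm (h : S.IsReebQuotient U R π) (hS : S.HVanishes)
    (B : FlowBox U R π y₀) : Nonempty (NormalForm S B) := by
  obtain ⟨A, hA, hAD⟩ := B.exists_graph h
  let F : GraphForm S B := ⟨A, hA, hAD⟩
  refine ⟨⟨F.base, fun y => F.metric (y, B.c.2), GraphForm.contDiffOn_slice F.smooth,
    fun v w => GraphForm.contDiffOn_slice (F.contDiffOn_metric v w), fun q hq u => ?_,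
    fun q hq u v => ?_, fun y v w => S.symm_g _ _ _, fun y hy => ?_⟩⟩
  · rw [← F.A_eq_base h (B.e.map_source hq)]
    exact F.mem_iff q hq u
  · rw [← F.metric_eq h hS (B.e.map_source hq)]
    exact F.g_eq_metric hq u v
  · have hx := GraphForm.mem_target_of_mem_ball hy
    have hxs : B.e.symm (y, B.c.2) ∈ B.e.source := B.e.map_target hx
    have hx' : B.e (B.e.symm (y, B.c.2)) = (y, B.c.2) := B.e.right_inv hx
    obtain ⟨X₁, X₂, h1, h2, h3, -, -, -, h4⟩ := F.exists_frame h hxs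
    rw [hx', F.fderiv_A h hx, F.fderiv_A h hx] at h4
    simp only [F.g_eq_metric hxs, hx'] at h1 h2 h3
    exact ⟨_, _, h1, h2, h3, h4⟩

lemma eq_sum_single (v : EuclideanSpace ℝ (Fin 2)) :
    v = v 0 • EuclideanSpace.single 0 1 + v 1 • EuclideanSpace.single 1 1 := by
  ext i
  fin_cases i <;> simp

lemma bilin_expand (G : LinearMap.BilinForm ℝ (EuclideanSpace ℝ (Fin 2)))
    (v w : EuclideanSpace ℝ (Fin 2)) :
    G v w = v 0 * (w 0 * G (.single 0 1) (.single 0 1) + w 1 * G (.single 0 1) (.single 1 1)) +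
      v 1 * (w 0 * G (.single 1 1) (.single 0 1) + w 1 * G (.single 1 1) (.single 1 1)) := by
  conv_lhs => rw [eq_sum_single v, eq_sum_single w]
  simp only [map_add, map_smul, LinearMap.add_apply, LinearMap.smul_apply, smul_eq_mul]
  ring

/-- Smoothness is given only on constant vectors; expansion in the standard basis extends it to
varying ones. -/
lemma contDiffOn_bilin_apply {P : Type*} [NormedAddCommGroup P] [NormedSpace ℝ P] {s : Set P}
    {G : P → LinearMap.BilinForm ℝ (EuclideanSpace ℝ (Fin 2))}
    (hG : ∀ v w, ContDiffOn ℝ ∞ (fun y => G y v w) s) {V W : P → EuclideanSpace ℝ (Fin 2)}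
    (hV : ContDiffOn ℝ ∞ V s) (hW : ContDiffOn ℝ ∞ W s) :
    ContDiffOn ℝ ∞ (fun y => G y (V y) (W y)) s := by
  have hV' := (contDiffOn_piLp 2).1 hV
  have hW' := (contDiffOn_piLp 2).1 hW
  refine ContDiffOn.congr ?_ fun y _ => bilin_expand (G y) (V y) (W y)
  exact ((hV' 0).mul (((hW' 0).mul (hG _ _)).add ((hW' 1).mul (hG _ _)))).add
    ((hV' 1).mul (((hW' 0).mul (hG _ _)).add ((hW' 1).mul (hG _ _))))

/-- The differential of the chart of the base under a flow box. -/
def dchart (y₀ y : N) : EuclideanSpace ℝ (Fin 2) →ₗ[ℝ] EuclideanSpace ℝ (Fin 2) :=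
  (mfderiv (𝓡 2) 𝓘(ℝ, EuclideanSpace ℝ (Fin 2)) (chartDiffeo (n := 2) y₀) y).toLinearMap

lemma dchart_injective {y : N} (hy : y ∈ (chartDiffeo (n := 2) y₀).source) :
    Function.Injective (dchart y₀ y) :=
  (isInvertible_mfderiv_partialDiffeomorph (chartDiffeo (n := 2) y₀) hy).injective

/-- The differential of a map into a surface. -/
def dproj (π : M → N) (p : M) : TangentSpace (𝓡 3) p →ₗ[ℝ] EuclideanSpace ℝ (Fin 2) :=
  (mfderiv (𝓡 3) (𝓡 2) π p).toLinearMap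

lemma FlowBox.d_fst (h : S.IsReebQuotient U R π) (B : FlowBox U R π y₀) {q : M}
    (hq : q ∈ B.e.source) (u : TangentSpace (𝓡 3) q) :
    (B.d q u).1 = dchart y₀ (π q) (dproj π q u) := by
  have h1 := (B.e.mdifferentiableAt (by simp) hq).hasMFDerivAt
  have h1' : HasMFDerivAt (𝓡 3) 𝓘(ℝ, EuclideanSpace ℝ (Fin 2)) (fun x => (B.e x).1) q
      ((ContinuousLinearMap.fst ℝ (EuclideanSpace ℝ (Fin 2)) ℝ).comp
        (mfderiv (𝓡 3) 𝓘(ℝ, EuclideanSpace ℝ (Fin 2) × ℝ) B.e q)) :=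
    (ContinuousLinearMap.fst ℝ (EuclideanSpace ℝ (Fin 2)) ℝ).hasMFDerivAt.comp q h1
  have h2 : MDifferentiableAt (𝓡 3) (𝓡 2) π q := (h.smooth.contMDiffAt
    (h.reeb.isOpen.mem_nhds (B.source_subset hq))).mdifferentiableAt (by simp)
  have h3 := (((chartDiffeo (n := 2) y₀).mdifferentiableAt (by simp)
    (B.proj_mem q hq)).hasMFDerivAt).comp q h2.hasMFDerivAt
  have h4 := hasMFDerivAt_unique h1' (h3.congr_of_eventuallyEq (by
    filter_upwards [B.e.open_source.mem_nhds hq] with x hx using B.fst_eq x hx))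
  exact congrArg (fun L : EuclideanSpace ℝ (Fin 3) →L[ℝ] EuclideanSpace ℝ (Fin 2) => L u) h4

lemma dproj_injective (h : S.IsReebQuotient U R π) (hS : S.HVanishes) {p : M} (hp : p ∈ U)
    {u v : S.D p} (huv : dproj π p u = dproj π p v) : u = v := by
  obtain ⟨B, hB⟩ := exists_flowBox h hp
  obtain ⟨F⟩ := nonempty_normalForm h hS B
  apply Subtype.ext
  apply FlowBox.d_injective hB
  have h1 : (B.d p u).1 = (B.d p v).1 := by rw [B.d_fst h hB, B.d_fst h hB, huv]
  refine Prod.ext h1 ?_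
  rw [(F.mem_iff p hB u).1 u.2, (F.mem_iff p hB v).1 v.2, h1]

lemma dproj_surjective (h : S.IsReebQuotient U R π) (hS : S.HVanishes) {p : M} (hp : p ∈ U)
    (w : EuclideanSpace ℝ (Fin 2)) : ∃ u : S.D p, dproj π p u = w := by
  obtain ⟨B, hB⟩ := exists_flowBox h hp
  obtain ⟨F⟩ := nonempty_normalForm h hS B
  obtain ⟨u, hu⟩ := FlowBox.d_surjective hB
    (dchart (π p) (π p) w, F.a (B.e p).1 (dchart (π p) (π p) w))
  refine ⟨⟨u, (F.mem_iff p hB u).2 (by rw [hu])⟩, ?_⟩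
  apply dchart_injective (B.proj_mem p hB)
  rw [← B.d_fst h hB, hu]

/-! ### Descent of the metric to the quotient. -/

/-- The metrics on the contact planes at `p` and `q` induce the same metric on the base. -/
def Compat (S : ContactStructure M) (π : M → N) (p q : M) : Prop :=
  ∀ (u v : S.D p) (u' v' : S.D q), dproj π p u = dproj π q u' → dproj π p v = dproj π q v' →
    S.g p u v = S.g q u' v'

lemma Compat.symm {p q : M} (hpq : Compat S π p q) : Compat S π q p :=
  fun u v u' v' hu hv => (hpq u' v' u v hu.symm hv.symm).symm

/-- The comparison through `q` needs vectors of `D q` over the given base vectors, hence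
surjectivity of `dπ` on `D q`. -/
lemma Compat.trans (h : S.IsReebQuotient U R π) (hS : S.HVanishes) {p q r : M} (hq : q ∈ U)
    (hpq : Compat S π p q) (hqr : Compat S π q r) : Compat S π p r := by
  intro u v u' v' hu hv
  obtain ⟨a, ha⟩ := dproj_surjective h hS hq (dproj π p u)
  obtain ⟨b, hb⟩ := dproj_surjective h hS hq (dproj π p v)
  exact (hpq u v a b ha.symm hb.symm).trans (hqr a b u' v' (ha.trans hu) (hb.trans hv))

lemma compat_of_mem_flowBox (h : S.IsReebQuotient U R π) (hS : S.HVanishes)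
    (B : FlowBox U R π y₀) {p q : M} (hp : p ∈ B.e.source) (hq : q ∈ B.e.source)
    (hpq : π p = π q) : Compat S π p q := by
  intro u v u' v' hu hv
  obtain ⟨F⟩ := nonempty_normalForm h hS B
  rw [F.g_eq p hp, F.g_eq q hq, B.d_fst h hp, B.d_fst h hp, B.d_fst h hq, B.d_fst h hq, hu, hv,
    B.fst_eq p hp, B.fst_eq q hq, hpq]

/-- The two points are joined by a trajectory. Nearby points of it share a flow box, where `g`
depends only on base data, and connectedness of the parameter interval does the rest. -/
lemma compat_of_eq (h : S.IsReebQuotient U R π) (hS : S.HVanishes) {p q : M} (hp : p ∈ U)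
    (hq : q ∈ U) (hpq : π p = π q) : Compat S π p q := by
  obtain ⟨γ, a, b, hγ, hγU, rfl, rfl⟩ := (h.fibre p hp q hq).1 hpq
  have hconst : ∀ t ∈ uIcc a b, π (γ t) = π (γ a) := fun t ht =>
    have hs : uIcc a t ⊆ uIcc a b := uIcc_subset_uIcc_left ht
    ((h.fibre _ hp _ (hγU ht)).2 ⟨γ, a, t, hγ.mono hs, hγU.mono_left hs, rfl, rfl⟩).symm
  have key : ∀ t ∈ uIcc a b, ∀ᶠ s in 𝓝[uIcc a b] t,
      s ∈ uIcc a b ∧ Compat S π (γ t) (γ s) := by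
    intro t ht
    obtain ⟨B, hB⟩ := exists_flowBox h (hγU ht)
    have hc : ContinuousWithinAt γ (uIcc a b) t := (hγ t ht).continuousWithinAt
    filter_upwards [hc (B.e.open_source.mem_nhds hB), self_mem_nhdsWithin] with s hs hs'
    exact ⟨hs', compat_of_mem_flowBox h hS B hB hs ((hconst t ht).trans (hconst s hs').symm)⟩
  have hpre : IsPreconnected (uIcc a b) := isPreconnected_uIcc
  refine hpre.induction₂' (fun s t => Compat S π (γ s) (γ t)) (fun t ht => ?_)
    (fun r s t _ hs _ hrs hst => hrs.trans h hS (hγU hs) hst) left_mem_uIcc right_mem_uIcc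
  filter_upwards [key t ht] with s hs
  exact ⟨hs.2, hs.2.symm⟩

lemma g_nondegenerate (h : S.IsReebQuotient U R π) {p : M} (hp : p ∈ U) {u : S.D p}
    (hu : ∀ v, S.g p u v = 0) : u = 0 := by
  obtain ⟨W, -, hpW, -, X₁, X₂, hX, -⟩ := h.reeb.frame p hp
  obtain ⟨s, t, hst⟩ := exists_combination (S.finrank_D p) (hX.linearIndependent hpW) u
  have h1 := hu (X₁ p)
  have h2 := hu (X₂ p)
  rw [hst, S.symm_g, map_add, map_smul, map_smul] at h1 h2
  rw [hX.fst_snd p hpW] at h1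
  rw [S.symm_g, hX.fst_snd p hpW, hX.snd_snd p hpW] at h2
  simp only [smul_eq_mul, mul_zero, add_zero, zero_add, mul_one] at h1 h2
  have hs : s = 0 := by
    rcases hX.fst_fst p hpW with h3 | h3 <;> rw [h3] at h1 <;> linarith
  rw [hst, hs, h2]
  simp

/-- In a flow box a projected metric is the metric of the normal form. -/
lemma form_eq_normalForm (h : S.IsReebQuotient U R π)
    {B : FlowBox U R π y₀} (F : NormalForm S B)
    {form : ∀ y : N, LinearMap.BilinForm ℝ (TangentSpace (𝓡 2) y)}
    (hform : ∀ p ∈ U, ∀ u v : S.D p, form (π p) (mfderiv (𝓡 3) (𝓡 2) π p u)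
      (mfderiv (𝓡 3) (𝓡 2) π p v) = S.g p u v)
    {y : N} (hy : y ∈ (chartDiffeo (n := 2) y₀).source)
    (hy' : chartDiffeo (n := 2) y₀ y ∈ Metric.ball B.c.1 B.r) (u v : TangentSpace (𝓡 2) y) :
    form y u v = F.G (chartDiffeo (n := 2) y₀ y) (dchart y₀ y u) (dchart y₀ y v) := by
  have hx := GraphForm.mem_target_of_mem_ball hy'
  obtain ⟨q, hxs, hqe⟩ : ∃ q ∈ B.e.source, B.e q = (chartDiffeo (n := 2) y₀ y, B.c.2) :=
    ⟨_, B.e.map_target hx, B.e.right_inv hx⟩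
  have hπ : π q = y := (chartDiffeo (n := 2) y₀).injOn (B.proj_mem q hxs) hy
    ((B.fst_eq q hxs).symm.trans (congrArg Prod.fst hqe))
  subst hπ
  have key : ∀ w : TangentSpace (𝓡 2) (π q), ∃ w' : S.D q, mfderiv (𝓡 3) (𝓡 2) π q w' = w := by
    intro w
    obtain ⟨u, hu⟩ := FlowBox.d_surjective hxs
      (dchart y₀ (π q) w, F.a (B.e q).1 (dchart y₀ (π q) w))
    refine ⟨⟨u, (F.mem_iff q hxs u).2 (by rw [hu])⟩, ?_⟩
    apply dchart_injective (B.proj_mem q hxs)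
    exact (B.d_fst h hxs u).symm.trans (by rw [hu])
  obtain ⟨u', rfl⟩ := key u
  obtain ⟨v', rfl⟩ := key v
  rw [hform q (B.source_subset hxs), F.g_eq q hxs, B.d_fst h hxs, B.d_fst h hxs, hqe]
  rfl

/-- The existence and uniqueness of the projected metric. -/
theorem existsUnique_projection (h : S.IsReebQuotient U R π) (hS : S.HVanishes) :
    ∃! g : SurfaceMetric N, S.IsProjection U π g := by
  have hsurj : ∀ y : N, ∃ p ∈ U, π p = y := fun y => by
    obtain ⟨p, hp, hpy⟩ := h.surj (mem_univ y)
    exact ⟨p, hp, hpy⟩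
  -- An arbitrary section, with no continuity: `compat_of_eq` makes the metric independent of it,
  -- and smoothness is read off from the normal form.
  choose σ hσU hσ using hsurj
  let L : ∀ p : M, S.D p →ₗ[ℝ] EuclideanSpace ℝ (Fin 2) := fun p => dproj π p ∘ₗ (S.D p).subtype
  have hL : ∀ p ∈ U, Function.Bijective (L p) := fun p hp =>
    ⟨fun u v huv => dproj_injective h hS hp huv, fun w => dproj_surjective h hS hp w⟩
  let Λ : ∀ y : N, S.D (σ y) ≃ₗ[ℝ] EuclideanSpace ℝ (Fin 2) := fun y =>
    LinearEquiv.ofBijective (L (σ y)) (hL _ (hσU y))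
  let form : ∀ y : N, LinearMap.BilinForm ℝ (EuclideanSpace ℝ (Fin 2)) := fun y =>
    (S.g (σ y)).compl₁₂ (Λ y).symm.toLinearMap (Λ y).symm.toLinearMap
  have hΛ : ∀ y w, dproj π (σ y) ((Λ y).symm w) = w := fun y w => (Λ y).apply_symm_apply w
  have hform : ∀ p ∈ U, ∀ u v : S.D p,
      form (π p) (dproj π p u) (dproj π p v) = S.g p u v := fun p hp u v =>
    compat_of_eq h hS (hσU _) hp (hσ _) _ _ u v (hΛ _ _) (hΛ _ _)
  let g : SurfaceMetric N := {
    form := form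
    symm := fun y u v => S.symm_g _ _ _
    nondeg := fun y u hu => by
      have h1 : (Λ y).symm u = 0 := g_nondegenerate h (hσU y) fun v => by
        have := hu (Λ y v)
        change S.g (σ y) ((Λ y).symm u) ((Λ y).symm (Λ y v)) = 0 at this
        rwa [LinearEquiv.symm_apply_apply] at this
      exact (Λ y).symm.map_eq_zero_iff.1 h1
    smooth := fun W hW X Y hX hY y hy => by
      obtain ⟨p, hp, rfl⟩ : ∃ p ∈ U, π p = y := ⟨σ y, hσU y, hσ y⟩
      obtain ⟨B, hB⟩ := exists_flowBox h hp
      obtain ⟨F⟩ := nonempty_normalForm h hS B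
      set κ := chartDiffeo (n := 2) (π p) with hκ
      have hyκ : π p ∈ κ.source := B.proj_mem _ hB
      have hyb : κ (π p) ∈ Metric.ball B.c.1 B.r := by
        rw [← B.fst_eq _ hB]
        exact GraphForm.fst_mem_ball (B.e.map_source hB)
      set O := (κ.target ∩ κ.symm ⁻¹' W) ∩ Metric.ball B.c.1 B.r with hO
      have hOo : IsOpen O :=
        (κ.symm.toOpenPartialHomeomorph.isOpen_inter_preimage hW).inter Metric.isOpen_ball
      have hyO : κ (π p) ∈ O := ⟨⟨κ.map_source hyκ, by
        rwa [mem_preimage, symm_apply_apply κ hyκ]⟩, hyb⟩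
      have h1 : ContDiffOn ℝ ∞ (fun x => F.G x (push κ X x) (push κ Y x)) O :=
        contDiffOn_bilin_apply (fun v w => (F.contDiffOn_G v w).mono inter_subset_right)
          ((contDiffOn_push κ hW hX).mono inter_subset_left)
          ((contDiffOn_push κ hW hY).mono inter_subset_left)
      have h2 := ((h1.contDiffAt (hOo.mem_nhds hyO)).contMDiffAt).comp (π p)
        (κ.contMDiffOn.contMDiffAt (κ.open_source.mem_nhds hyκ))
      refine (h2.congr_of_eventuallyEq ?_).contMDiffWithinAt
      have h3 : IsOpen (κ.source ∩ κ ⁻¹' Metric.ball B.c.1 B.r) :=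
        κ.toOpenPartialHomeomorph.isOpen_inter_preimage Metric.isOpen_ball
      filter_upwards [h3.mem_nhds ⟨hyκ, hyb⟩] with z hz
      refine (form_eq_normalForm h F hform hz.1 hz.2 (X z) (Y z)).trans ?_
      change _ = F.G (κ z) (push κ X (κ z)) (push κ Y (κ z))
      rw [push_apply κ X hz.1, push_apply κ Y hz.1]
      rfl }
  refine ⟨g, hform, fun g' hg' => ?_⟩
  -- Every tangent vector of `N` is the image of a vector of `D`, and on such images both forms
  -- equal `g`.
  ext y u v
  obtain ⟨p, hp, rfl⟩ : ∃ p ∈ U, π p = y := ⟨σ y, hσU y, hσ y⟩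
  obtain ⟨u', hu'⟩ := dproj_surjective h hS hp u
  obtain ⟨v', hv'⟩ := dproj_surjective h hS hp v
  subst hu' hv'
  exact (hg' p hp u' v').trans (hform p hp u' v').symm

end ReebQuotient

/-! ### Area forms and 1-forms in the plane. -/

section Plane

/-- The exterior derivative of a `1`-form on the plane. -/
def curl (a : EuclideanSpace ℝ (Fin 2) → EuclideanSpace ℝ (Fin 2) →L[ℝ] ℝ)
    (y v w : EuclideanSpace ℝ (Fin 2)) : ℝ := fderiv ℝ a y v w - fderiv ℝ a y w v

lemma curl_expand (a : EuclideanSpace ℝ (Fin 2) → EuclideanSpace ℝ (Fin 2) →L[ℝ] ℝ)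
    (y v w : EuclideanSpace ℝ (Fin 2)) :
    curl a y v w = (v 0 * w 1 - v 1 * w 0) * curl a y (.single 0 1) (.single 1 1) := by
  unfold curl
  conv_lhs => rw [eq_sum_single v, eq_sum_single w]
  simp only [map_add, map_smul, add_apply, smul_apply, smul_eq_mul]
  ring

/-- If a metric has an orthonormal frame on which the exterior derivative of a `1`-form is one,
then that derivative is the area form. -/
lemma curl_sq {a : EuclideanSpace ℝ (Fin 2) → EuclideanSpace ℝ (Fin 2) →L[ℝ] ℝ}
    {y : EuclideanSpace ℝ (Fin 2)} {G : LinearMap.BilinForm ℝ (EuclideanSpace ℝ (Fin 2))}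
    (hG : ∀ v w, G v w = G w v) {v₁ v₂ : EuclideanSpace ℝ (Fin 2)}
    (h₁ : G v₁ v₁ = 1 ∨ G v₁ v₁ = -1) (h₂ : G v₂ v₂ = 1) (h₁₂ : G v₁ v₂ = 0)
    (hc : curl a y v₁ v₂ = 1) (v w : EuclideanSpace ℝ (Fin 2)) :
    curl a y v w ^ 2 = |G v v * G w w - G v w ^ 2| := by
  -- Cramer's rule: a 2-form equal to one on `(v₁, v₂)` reads off coordinates in that basis.
  have hexp : ∀ u, u = curl a y u v₂ • v₁ - curl a y u v₁ • v₂ := fun u => by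
    rw [curl_expand] at hc
    ext i
    fin_cases i
    · simp only [curl_expand a y u, PiLp.sub_apply, PiLp.smul_apply, smul_eq_mul, Fin.zero_eta]
      linear_combination (-(u 0)) * hc
    · simp only [curl_expand a y u, PiLp.sub_apply, PiLp.smul_apply, smul_eq_mul, Fin.mk_one]
      linear_combination (-(u 1)) * hc
  have hcvw : curl a y v w = curl a y v v₂ * -curl a y w v₁ + curl a y v v₁ * curl a y w v₂ := by
    rw [curl_expand] at hc
    rw [curl_expand a y v w, curl_expand a y v v₂, curl_expand a y w v₁, curl_expand a y v v₁,
      curl_expand a y w v₂]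
    linear_combination (-((v 0 * w 1 - v 1 * w 0) * curl a y (.single 0 1) (.single 1 1))) * hc
  have hGuu : ∀ u u', G u u' = curl a y u v₂ * curl a y u' v₂ * G v₁ v₁ +
      curl a y u v₁ * curl a y u' v₁ := fun u u' => by
    conv_lhs => rw [hexp u, hexp u']
    simp only [map_sub, map_smul, LinearMap.sub_apply, LinearMap.smul_apply, smul_eq_mul, h₂, h₁₂,
      hG v₂ v₁]
    ring
  -- The Gram determinant is the squared area times the sign `G v₁ v₁`, which records the signature
  -- and disappears under the absolute value.
  have hgram : G v v * G w w - G v w ^ 2 = G v₁ v₁ * curl a y v w ^ 2 := by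
    rw [hGuu v v, hGuu w w, hGuu v w, hcvw]; ring
  rw [hgram, abs_mul, abs_of_nonneg (sq_nonneg (curl a y v w))]
  rcases h₁ with h | h <;> rw [h] <;> simp

lemma curl_single_ne_zero {a : EuclideanSpace ℝ (Fin 2) → EuclideanSpace ℝ (Fin 2) →L[ℝ] ℝ}
    {y v w : EuclideanSpace ℝ (Fin 2)} (hc : curl a y v w = 1) :
    curl a y (.single 0 1) (.single 1 1) ≠ 0 := fun h => by
  rw [curl_expand, h, mul_zero] at hc
  exact zero_ne_one hc

/-- The second-derivative term is symmetric in `v`, `w` and so drops out of `curl`: exterior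
derivative commutes with pullback. -/
lemma fderiv_pullback {a : EuclideanSpace ℝ (Fin 2) → EuclideanSpace ℝ (Fin 2) →L[ℝ] ℝ}
    {ψ : EuclideanSpace ℝ (Fin 2) → EuclideanSpace ℝ (Fin 2)} {y : EuclideanSpace ℝ (Fin 2)}
    (ha : DifferentiableAt ℝ a (ψ y)) (hψ : ContDiffAt ℝ ∞ ψ y) (v w : EuclideanSpace ℝ (Fin 2)) :
    fderiv ℝ (fun y => (a (ψ y)).comp (fderiv ℝ ψ y)) y v w =
      fderiv ℝ a (ψ y) (fderiv ℝ ψ y v) (fderiv ℝ ψ y w) +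
        a (ψ y) (fderiv ℝ (fderiv ℝ ψ) y v w) := by
  have h1 : HasFDerivAt (fun y => a (ψ y)) ((fderiv ℝ a (ψ y)).comp (fderiv ℝ ψ y)) y :=
    ha.hasFDerivAt.comp y (hψ.differentiableAt (by simp)).hasFDerivAt
  have h2 : HasFDerivAt (fderiv ℝ ψ) (fderiv ℝ (fderiv ℝ ψ) y) y :=
    ((hψ.fderiv_right (m := ∞) (by simp)).differentiableAt (by simp)).hasFDerivAt
  rw [(h1.clm_comp h2).fderiv]
  simp
  ring

/-- Two `1`-forms whose derivatives are area forms of isometric metrics agree under the isometry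
up to sign and a differential. -/
lemma exists_primitive_of_curl {a₁ a₂ : EuclideanSpace ℝ (Fin 2) → EuclideanSpace ℝ (Fin 2) →L[ℝ] ℝ}
    {ψ : EuclideanSpace ℝ (Fin 2) → EuclideanSpace ℝ (Fin 2)} {c : EuclideanSpace ℝ (Fin 2)} {s : ℝ}
    {O : Set (EuclideanSpace ℝ (Fin 2))} (hO : IsOpen O)
    (ha₁ : ContDiffOn ℝ ∞ a₁ (Metric.ball c s)) (ha₂ : ContDiffOn ℝ ∞ a₂ O)
    (hψ : ContDiffOn ℝ ∞ ψ (Metric.ball c s)) (hψO : MapsTo ψ (Metric.ball c s) O)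
    (hsq : ∀ y ∈ Metric.ball c s,
      curl a₂ (ψ y) (fderiv ℝ ψ y (.single 0 1)) (fderiv ℝ ψ y (.single 1 1)) ^ 2 =
        curl a₁ y (.single 0 1) (.single 1 1) ^ 2)
    (hne : ∀ y ∈ Metric.ball c s, curl a₁ y (.single 0 1) (.single 1 1) ≠ 0) :
    ∃ δ : ℝ, δ * δ = 1 ∧ ∃ f : EuclideanSpace ℝ (Fin 2) → ℝ, ContDiffOn ℝ ∞ f (Metric.ball c s) ∧
      ∀ y ∈ Metric.ball c s,
        HasFDerivAt f ((a₂ (ψ y)).comp (fderiv ℝ ψ y) - δ • a₁ y) y := by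
  have hb : IsOpen (Metric.ball c s) := Metric.isOpen_ball
  have hdψ : ContDiffOn ℝ ∞ (fderiv ℝ ψ) (Metric.ball c s) := hψ.fderiv_of_isOpen hb (by simp)
  have hda₁ : ContDiffOn ℝ ∞ (fderiv ℝ a₁) (Metric.ball c s) := ha₁.fderiv_of_isOpen hb (by simp)
  have hda₂ : ContDiffOn ℝ ∞ (fun y => fderiv ℝ a₂ (ψ y)) (Metric.ball c s) :=
    (ha₂.fderiv_of_isOpen hO (by simp)).comp hψ hψO
  have hk₁ : ContinuousOn (fun y => curl a₁ y (.single 0 1) (.single 1 1)) (Metric.ball c s) :=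
    (((hda₁.clm_apply contDiffOn_const).clm_apply contDiffOn_const).sub
      ((hda₁.clm_apply contDiffOn_const).clm_apply contDiffOn_const)).continuousOn
  have hk₂ : ContinuousOn (fun y => curl a₂ (ψ y) (fderiv ℝ ψ y (.single 0 1))
      (fderiv ℝ ψ y (.single 1 1))) (Metric.ball c s) :=
    (((hda₂.clm_apply (hdψ.clm_apply contDiffOn_const)).clm_apply
      (hdψ.clm_apply contDiffOn_const)).sub
      ((hda₂.clm_apply (hdψ.clm_apply contDiffOn_const)).clm_apply
      (hdψ.clm_apply contDiffOn_const))).continuousOn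
  obtain ⟨δ, hδ, hk⟩ : ∃ δ : ℝ, δ * δ = 1 ∧ ∀ y ∈ Metric.ball c s,
      curl a₂ (ψ y) (fderiv ℝ ψ y (.single 0 1)) (fderiv ℝ ψ y (.single 1 1)) =
        δ * curl a₁ y (.single 0 1) (.single 1 1) := by
    -- Two continuous functions with equal squares, one of them nowhere zero, differ by a constant
    -- sign on a connected set. The sign tells whether `ψ` preserves the orientations given by the
    -- two area forms.
    rcases (convex_ball c s).isPreconnected.eq_or_eq_neg_of_sq_eq hk₂ hk₁ hsq
      (fun {x} hx => hne x hx) with h | h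
    · exact ⟨1, by norm_num, fun y hy => by rw [one_mul]; exact h hy⟩
    · exact ⟨-1, by norm_num, fun y hy => by rw [neg_one_mul]; exact h hy⟩
  refine ⟨δ, hδ, exists_contDiffOn_primitive (convex_ball c s) hb
    (((ha₂.comp hψ hψO).clm_comp hdψ).sub (ha₁.const_smul δ)) fun y hy v w => ?_⟩
  have hy' := hb.mem_nhds hy
  have hψy := hψ.contDiffAt hy'
  have hd₂ : DifferentiableAt ℝ a₂ (ψ y) :=
    (ha₂.contDiffAt (hO.mem_nhds (hψO hy))).differentiableAt (by simp)
  have hd₁ : DifferentiableAt ℝ a₁ y := (ha₁.contDiffAt hy').differentiableAt (by simp)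
  have hp : DifferentiableAt ℝ (fun y => (a₂ (ψ y)).comp (fderiv ℝ ψ y)) y :=
    ((((ha₂.comp hψ hψO).clm_comp hdψ)).contDiffAt hy').differentiableAt (by simp)
  have hsymm : fderiv ℝ (fderiv ℝ ψ) y v w = fderiv ℝ (fderiv ℝ ψ) y w v :=
    (hψy.isSymmSndFDerivAt (by rw [minSmoothness_of_isRCLikeNormedField]; exact ENat.LEInfty.out))
      v w
  have hexp : ∀ v w, fderiv ℝ (fun y => (a₂ (ψ y)).comp (fderiv ℝ ψ y) - δ • a₁ y) y v w =
      fderiv ℝ a₂ (ψ y) (fderiv ℝ ψ y v) (fderiv ℝ ψ y w) +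
        a₂ (ψ y) (fderiv ℝ (fderiv ℝ ψ) y v w) - δ * fderiv ℝ a₁ y v w := fun v w => by
    rw [(hp.hasFDerivAt.fun_sub (hd₁.hasFDerivAt.fun_const_smul δ)).fderiv]
    simp only [sub_apply, smul_apply, smul_eq_mul]
    rw [fderiv_pullback hd₂ hψy]
  have hcurl : curl a₂ (ψ y) (fderiv ℝ ψ y v) (fderiv ℝ ψ y w) = δ * curl a₁ y v w := by
    have h1 := hk y hy
    have h2 : curl a₂ (ψ y) (fderiv ℝ ψ y v) (fderiv ℝ ψ y w) = (v 0 * w 1 - v 1 * w 0) *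
        curl a₂ (ψ y) (fderiv ℝ ψ y (.single 0 1)) (fderiv ℝ ψ y (.single 1 1)) := by
      conv_lhs => rw [eq_sum_single v, eq_sum_single w]
      simp only [curl, map_add, map_smul, add_apply, smul_apply, smul_eq_mul]
      ring
    rw [h2, h1, curl_expand a₁ y v w]; ring
  unfold curl at hcurl
  rw [hexp, hexp, hsymm]
  linarith

/-- The map `(y, z) ↦ (ψ y, δ z + f y)` as a partial diffeomorphism. -/
def shear (ψ : PartialDiffeomorph (𝓡 2) (𝓡 2) (EuclideanSpace ℝ (Fin 2))
    (EuclideanSpace ℝ (Fin 2)) ∞) {b : Set (EuclideanSpace ℝ (Fin 2))} (hb : IsOpen b)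
    (hbψ : b ⊆ ψ.source) {δ : ℝ} (hδ : δ * δ = 1) {f : EuclideanSpace ℝ (Fin 2) → ℝ}
    (hf : ContDiffOn ℝ ∞ f b) :
    PartialDiffeomorph 𝓘(ℝ, EuclideanSpace ℝ (Fin 2) × ℝ) 𝓘(ℝ, EuclideanSpace ℝ (Fin 2) × ℝ)
      (EuclideanSpace ℝ (Fin 2) × ℝ) (EuclideanSpace ℝ (Fin 2) × ℝ) ∞ where
  toFun x := (ψ x.1, δ * x.2 + f x.1)
  -- Since `δ * δ = 1`, dividing by `δ` is multiplying by it.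
  invFun x := (ψ.symm x.1, δ * (x.2 - f (ψ.symm x.1)))
  source := b ×ˢ univ
  target := (ψ.target ∩ ψ.symm ⁻¹' b) ×ˢ univ
  map_source' x hx := ⟨⟨ψ.map_source (hbψ hx.1), by
    have : ψ.symm (ψ x.1) = x.1 := ψ.left_inv (hbψ hx.1)
    rw [mem_preimage, this]; exact hx.1⟩, trivial⟩
  map_target' x hx := ⟨hx.1.2, trivial⟩
  left_inv' x hx := by
    have h : ψ.symm (ψ x.1) = x.1 := ψ.left_inv (hbψ hx.1)
    refine Prod.ext h ?_
    simp only [h]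
    linear_combination x.2 * hδ
  right_inv' x hx := by
    have h : ψ (ψ.symm x.1) = x.1 := ψ.right_inv hx.1.1
    refine Prod.ext h ?_
    linear_combination (x.2 - f (ψ.symm x.1)) * hδ
  open_source := hb.prod isOpen_univ
  open_target := (ψ.symm.toOpenPartialHomeomorph.isOpen_inter_preimage hb).prod isOpen_univ
  contMDiffOn_toFun := by
    rw [contMDiffOn_iff_contDiffOn]
    have hψ : ContDiffOn ℝ ∞ ψ b := (contMDiffOn_iff_contDiffOn.1 ψ.contMDiffOn).mono hbψ
    have hm : MapsTo Prod.fst (b ×ˢ (univ : Set ℝ)) b := fun x hx => hx.1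
    exact (hψ.comp contDiffOn_fst hm).prodMk
      ((contDiffOn_const.mul contDiffOn_snd).add (hf.comp contDiffOn_fst hm))
  contMDiffOn_invFun := by
    rw [contMDiffOn_iff_contDiffOn]
    have hψ : ContDiffOn ℝ ∞ ψ.symm (ψ.target ∩ ψ.symm ⁻¹' b) :=
      (contMDiffOn_iff_contDiffOn.1 ψ.symm.contMDiffOn).mono inter_subset_left
    have hm : MapsTo Prod.fst ((ψ.target ∩ ψ.symm ⁻¹' b) ×ˢ (univ : Set ℝ))
      (ψ.target ∩ ψ.symm ⁻¹' b) := fun x hx => hx.1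
    have h1 := hψ.comp contDiffOn_fst hm
    exact h1.prodMk (contDiffOn_const.mul
      (contDiffOn_snd.sub (hf.comp h1 fun x hx => hx.1.2)))

end Plane

/-! ### Lifting an isometry of the quotients. -/

section Isometry

variable {M₁ : Type*} [TopologicalSpace M₁]
  [ChartedSpace (EuclideanSpace ℝ (Fin 3)) M₁] [IsManifold (𝓡 3) ∞ M₁]
  {M₂ : Type*} [TopologicalSpace M₂]
  [ChartedSpace (EuclideanSpace ℝ (Fin 3)) M₂] [IsManifold (𝓡 3) ∞ M₂]
  {N₁ : Type*} [TopologicalSpace N₁]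
  [ChartedSpace (EuclideanSpace ℝ (Fin 2)) N₁] [IsManifold (𝓡 2) ∞ N₁]
  {N₂ : Type*} [TopologicalSpace N₂]
  [ChartedSpace (EuclideanSpace ℝ (Fin 2)) N₂] [IsManifold (𝓡 2) ∞ N₂]
  {S₁ : ContactStructure M₁} {S₂ : ContactStructure M₂}
  {U₁ : Set M₁} {R₁ : ∀ p : M₁, TangentSpace (𝓡 3) p} {π₁ : M₁ → N₁}
  {U₂ : Set M₂} {R₂ : ∀ p : M₂, TangentSpace (𝓡 3) p} {π₂ : M₂ → N₂} {y₁ : N₁} {y₂ : N₂}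

/-- A map between surfaces in charts. -/
def inCharts (y₁ : N₁) (y₂ : N₂) (φ : PartialDiffeomorph (𝓡 2) (𝓡 2) N₁ N₂ ∞) :
    PartialDiffeomorph (𝓡 2) (𝓡 2) (EuclideanSpace ℝ (Fin 2)) (EuclideanSpace ℝ (Fin 2)) ∞ :=
  ((chartDiffeo (n := 2) y₁).symm.trans φ).trans (chartDiffeo (n := 2) y₂)

/-- The conditions for a point to be in the domain of `inCharts`, at a point of the manifold. -/
lemma mem_source_of_inCharts {φ : PartialDiffeomorph (𝓡 2) (𝓡 2) N₁ N₂ ∞} {z : N₁}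
    (hz : z ∈ (chartDiffeo (n := 2) y₁).source)
    (h : chartDiffeo (n := 2) y₁ z ∈ (inCharts y₁ y₂ φ).source) :
    z ∈ φ.source ∧ φ z ∈ (chartDiffeo (n := 2) y₂).source ∧
      inCharts y₁ y₂ φ (chartDiffeo (n := 2) y₁ z) = chartDiffeo (n := 2) y₂ (φ z) := by
  have hz' := symm_apply_apply (chartDiffeo (n := 2) y₁) hz
  obtain ⟨⟨-, h1⟩, h2⟩ := h
  change (chartDiffeo (n := 2) y₁).symm (chartDiffeo (n := 2) y₁ z) ∈ φ.source at h1
  change φ ((chartDiffeo (n := 2) y₁).symm (chartDiffeo (n := 2) y₁ z)) ∈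
    (chartDiffeo (n := 2) y₂).source at h2
  rw [hz'] at h1 h2
  refine ⟨h1, h2, ?_⟩
  change chartDiffeo (n := 2) y₂ (φ ((chartDiffeo (n := 2) y₁).symm (chartDiffeo (n := 2) y₁ z))) = _
  rw [hz']

lemma mem_inCharts_source {φ : PartialDiffeomorph (𝓡 2) (𝓡 2) N₁ N₂ ∞} {z : N₁}
    (hz : z ∈ (chartDiffeo (n := 2) y₁).source) (h1 : z ∈ φ.source)
    (h2 : φ z ∈ (chartDiffeo (n := 2) y₂).source) :
    chartDiffeo (n := 2) y₁ z ∈ (inCharts y₁ y₂ φ).source := by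
  have hz' := symm_apply_apply (chartDiffeo (n := 2) y₁) hz
  refine ⟨⟨(chartDiffeo (n := 2) y₁).map_source hz, ?_⟩, ?_⟩
  · change (chartDiffeo (n := 2) y₁).symm (chartDiffeo (n := 2) y₁ z) ∈ φ.source
    rwa [hz']
  · change φ ((chartDiffeo (n := 2) y₁).symm (chartDiffeo (n := 2) y₁ z)) ∈
      (chartDiffeo (n := 2) y₂).source
    rwa [hz']

lemma fderiv_inCharts {φ : PartialDiffeomorph (𝓡 2) (𝓡 2) N₁ N₂ ∞} {z : N₁}
    (hz : z ∈ (chartDiffeo (n := 2) y₁).source)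
    (h : chartDiffeo (n := 2) y₁ z ∈ (inCharts y₁ y₂ φ).source) (u : TangentSpace (𝓡 2) z) :
    fderiv ℝ (inCharts y₁ y₂ φ) (chartDiffeo (n := 2) y₁ z) (dchart y₁ z u) =
      dchart y₂ (φ z) (mfderiv (𝓡 2) (𝓡 2) φ z u) := by
  obtain ⟨h1, h2, -⟩ := mem_source_of_inCharts hz h
  have hκ₁ := (chartDiffeo (n := 2) y₁).mdifferentiableAt (by simp) hz
  have hκ₂ := (chartDiffeo (n := 2) y₂).mdifferentiableAt (by simp) h2
  have hφ := φ.mdifferentiableAt (by simp) h1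
  have hψ := (inCharts y₁ y₂ φ).mdifferentiableAt (by simp) h
  have e1 := hψ.hasMFDerivAt.comp z hκ₁.hasMFDerivAt
  have e2 := hκ₂.hasMFDerivAt.comp z hφ.hasMFDerivAt
  have hev : (inCharts y₁ y₂ φ) ∘ (chartDiffeo (n := 2) y₁) =ᶠ[𝓝 z]
      (chartDiffeo (n := 2) y₂) ∘ φ := by
    have ho : IsOpen ((chartDiffeo (n := 2) y₁).source ∩ (chartDiffeo (n := 2) y₁) ⁻¹'
        (inCharts y₁ y₂ φ).source) :=
      (chartDiffeo (n := 2) y₁).toOpenPartialHomeomorph.isOpen_inter_preimage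
        (inCharts y₁ y₂ φ).open_source
    filter_upwards [ho.mem_nhds ⟨hz, h⟩] with x hx
    exact (mem_source_of_inCharts hx.1 hx.2).2.2
  have e3 := hasMFDerivAt_unique e1 (e2.congr_of_eventuallyEq hev)
  rw [← mfderiv_eq_fderiv]
  exact congrArg (fun L : EuclideanSpace ℝ (Fin 2) →L[ℝ] EuclideanSpace ℝ (Fin 2) => L u) e3

/-- An isometry in charts preserves the metrics of the normal forms. -/
lemma normalForm_isometry (h₁ : S₁.IsReebQuotient U₁ R₁ π₁) (h₂ : S₂.IsReebQuotient U₂ R₂ π₂)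
    {B₁ : FlowBox U₁ R₁ π₁ y₁} {B₂ : FlowBox U₂ R₂ π₂ y₂} (F₁ : NormalForm S₁ B₁)
    (F₂ : NormalForm S₂ B₂) {g₁ : SurfaceMetric N₁} {g₂ : SurfaceMetric N₂}
    (hg₁ : S₁.IsProjection U₁ π₁ g₁) (hg₂ : S₂.IsProjection U₂ π₂ g₂)
    {φ : PartialDiffeomorph (𝓡 2) (𝓡 2) N₁ N₂ ∞} (hφ : IsSurfaceIsometry g₁ g₂ φ)
    {y : EuclideanSpace ℝ (Fin 2)} (hy : y ∈ (inCharts y₁ y₂ φ).source)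
    (hy₁ : y ∈ Metric.ball B₁.c.1 B₁.r) (hy₂ : inCharts y₁ y₂ φ y ∈ Metric.ball B₂.c.1 B₂.r)
    (v w : EuclideanSpace ℝ (Fin 2)) :
    F₂.G (inCharts y₁ y₂ φ y) (fderiv ℝ (inCharts y₁ y₂ φ) y v)
      (fderiv ℝ (inCharts y₁ y₂ φ) y w) = F₁.G y v w := by
  have hyt : y ∈ (chartDiffeo (n := 2) y₁).target := hy.1.1
  obtain ⟨z, hz, rfl⟩ : ∃ z ∈ (chartDiffeo (n := 2) y₁).source, chartDiffeo (n := 2) y₁ z = y :=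
    ⟨_, (chartDiffeo (n := 2) y₁).map_target hyt, (chartDiffeo (n := 2) y₁).right_inv hyt⟩
  obtain ⟨h1, h2, h3⟩ := mem_source_of_inCharts hz hy
  have hsurj : Function.Surjective (dchart y₁ z) :=
    (isInvertible_mfderiv_partialDiffeomorph (chartDiffeo (n := 2) y₁) hz).surjective
  obtain ⟨v, rfl⟩ := hsurj v
  obtain ⟨w, rfl⟩ := hsurj w
  have hd : ∀ u : EuclideanSpace ℝ (Fin 2),
      fderiv ℝ (inCharts y₁ y₂ φ) (chartDiffeo (n := 2) y₁ z) (dchart y₁ z u) =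
        dchart y₂ (φ z) (mfderiv (𝓡 2) (𝓡 2) φ z u) := fderiv_inCharts hz hy
  rw [hd, hd]
  rw [h3] at hy₂ ⊢
  exact (form_eq_normalForm h₂ F₂ hg₂ h2 hy₂ _ _).symm.trans
    ((hφ z h1 v w).trans (form_eq_normalForm h₁ F₁ hg₁ hz hy₁ v w))

/-- The frame is eliminated here: up to sign `da` depends on `G` alone, so that normal forms of two
structures can be compared. -/
lemma NormalForm.curl_sq (F : NormalForm S₁ (π := π₁) (U := U₁) (R := R₁) (y₀ := y₁) B)
    {y : EuclideanSpace ℝ (Fin 2)}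
    (hy : y ∈ Metric.ball B.c.1 B.r) (v w : EuclideanSpace ℝ (Fin 2)) :
    curl F.a y v w ^ 2 = |F.G y v v * F.G y w w - F.G y v w ^ 2| := by
  obtain ⟨v₁, v₂, h1, h2, h3, h4⟩ := F.frame y hy
  exact SubPR.curl_sq (F.symm y) h1 h2 h3 h4 v w

lemma fderiv_shear {ψ f : _} {δ : ℝ} {x : EuclideanSpace ℝ (Fin 2) × ℝ}
    {ψ' : EuclideanSpace ℝ (Fin 2) →L[ℝ] EuclideanSpace ℝ (Fin 2)}
    {f' : EuclideanSpace ℝ (Fin 2) →L[ℝ] ℝ} (hψ : HasFDerivAt ψ ψ' x.1)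
    (hf : HasFDerivAt f f' x.1) :
    HasFDerivAt (fun x : EuclideanSpace ℝ (Fin 2) × ℝ => (ψ x.1, δ * x.2 + f x.1))
      ((ψ'.comp (ContinuousLinearMap.fst ℝ _ ℝ)).prod
        (δ • ContinuousLinearMap.snd ℝ _ ℝ + f'.comp (ContinuousLinearMap.fst ℝ _ ℝ))) x :=
  (hψ.comp x hasFDerivAt_fst).prodMk
    ((hasFDerivAt_snd.const_mul δ).add (hf.comp x hasFDerivAt_fst))

/-- An isometry of the bases lifts to a local isometry of the contact structures. -/
theorem exists_contactIsometry (h₁ : S₁.IsReebQuotient U₁ R₁ π₁) (hS₁ : S₁.HVanishes)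
    (h₂ : S₂.IsReebQuotient U₂ R₂ π₂) (hS₂ : S₂.HVanishes)
    {g₁ : SurfaceMetric N₁} {g₂ : SurfaceMetric N₂}
    (hg₁ : S₁.IsProjection U₁ π₁ g₁) (hg₂ : S₂.IsProjection U₂ π₂ g₂)
    {φ : PartialDiffeomorph (𝓡 2) (𝓡 2) N₁ N₂ ∞} (hφ : IsSurfaceIsometry g₁ g₂ φ)
    {p₁ : M₁} (hp₁ : p₁ ∈ U₁) {p₂ : M₂} (hp₂ : p₂ ∈ U₂) (hpφ : π₁ p₁ ∈ φ.source)
    (hp : φ (π₁ p₁) = π₂ p₂) :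
    ∃ Φ : PartialDiffeomorph (𝓡 3) (𝓡 3) M₁ M₂ ∞,
      p₁ ∈ Φ.source ∧ Φ p₁ = p₂ ∧ Φ.source ⊆ U₁ ∧ Φ.target ⊆ U₂ ∧
      IsContactIsometry S₁ S₂ Φ ∧
      ∀ q ∈ Φ.source, π₁ q ∈ φ.source ∧ π₂ (Φ q) = φ (π₁ q) := by
  obtain ⟨B₁, hB₁⟩ := exists_flowBox h₁ hp₁
  obtain ⟨B₂, hB₂⟩ := exists_flowBox h₂ hp₂
  obtain ⟨F₁⟩ := nonempty_normalForm h₁ hS₁ B₁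
  obtain ⟨F₂⟩ := nonempty_normalForm h₂ hS₂ B₂
  set ψ := inCharts (π₁ p₁) (π₂ p₂) φ with hψdef
  have hpψ : (B₁.e p₁).1 ∈ ψ.source := by
    rw [B₁.fst_eq p₁ hB₁]
    exact mem_inCharts_source (B₁.proj_mem p₁ hB₁) hpφ (by rw [hp]; exact B₂.proj_mem p₂ hB₂)
  have hψp : ψ (B₁.e p₁).1 = (B₂.e p₂).1 := by
    have h := hpψ
    rw [B₁.fst_eq p₁ hB₁] at h ⊢
    rw [(mem_source_of_inCharts (B₁.proj_mem p₁ hB₁) h).2.2, hp, B₂.fst_eq p₂ hB₂]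
  have hψc : ContDiffOn ℝ ∞ ψ ψ.source := contMDiffOn_iff_contDiffOn.1 ψ.contMDiffOn
  obtain ⟨s, hs, hsub⟩ : ∃ s > 0, Metric.ball (B₁.e p₁).1 s ⊆
      (ψ.source ∩ ψ ⁻¹' Metric.ball B₂.c.1 B₂.r) ∩ Metric.ball B₁.c.1 B₁.r := by
    refine Metric.isOpen_iff.1 ((ψ.toOpenPartialHomeomorph.isOpen_inter_preimage
      Metric.isOpen_ball).inter Metric.isOpen_ball) _ ⟨⟨hpψ, ?_⟩, ?_⟩
    · rw [mem_preimage]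
      have := GraphForm.fst_mem_ball (B₂.e.map_source hB₂)
      rwa [← hψp] at this
    · exact GraphForm.fst_mem_ball (B₁.e.map_source hB₁)
  set b := Metric.ball (B₁.e p₁).1 s with hb
  have hbo : IsOpen b := Metric.isOpen_ball
  have hpb : (B₁.e p₁).1 ∈ b := Metric.mem_ball_self hs
  have hbψ : b ⊆ ψ.source := fun y hy => (hsub hy).1.1
  have hbB₂ : MapsTo ψ b (Metric.ball B₂.c.1 B₂.r) := fun y hy => (hsub hy).1.2
  have hbB₁ : b ⊆ Metric.ball B₁.c.1 B₁.r := fun y hy => (hsub hy).2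
  have hiso : ∀ y ∈ b, ∀ v w, F₂.G (ψ y) (fderiv ℝ ψ y v) (fderiv ℝ ψ y w) = F₁.G y v w :=
    fun y hy v w => normalForm_isometry h₁ h₂ F₁ F₂ hg₁ hg₂ hφ (hbψ hy) (hbB₁ hy) (hbB₂ hy) v w
  -- The isometry equates the Gram determinants, hence the squares of the two area forms.
  obtain ⟨δ, hδ, f₀, hf₀, hdf₀⟩ := exists_primitive_of_curl Metric.isOpen_ball
    (F₁.contDiffOn_a.mono hbB₁) F₂.contDiffOn_a (hψc.mono hbψ) hbB₂
    (fun y hy => by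
      rw [F₂.curl_sq (hbB₂ hy), F₁.curl_sq (hbB₁ hy)]
      simp only [hiso y hy])
    (fun y hy => by
      obtain ⟨v₁, v₂, -, -, -, hc⟩ := F₁.frame y (hbB₁ hy)
      exact curl_single_ne_zero hc)
  have hδ0 : δ ≠ 0 := fun h => by rw [h] at hδ; norm_num at hδ
  -- The primitive is free up to a constant, which is fixed so that the height of `p₁` goes to the
  -- height of `p₂`.
  obtain ⟨f, hf, hdf, hfp⟩ : ∃ f : EuclideanSpace ℝ (Fin 2) → ℝ, ContDiffOn ℝ ∞ f b ∧
      (∀ y ∈ b, HasFDerivAt f ((F₂.a (ψ y)).comp (fderiv ℝ ψ y) - δ • F₁.a y) y) ∧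
      δ * (B₁.e p₁).2 + f (B₁.e p₁).1 = (B₂.e p₂).2 :=
    ⟨fun y => f₀ y + ((B₂.e p₂).2 - δ * (B₁.e p₁).2 - f₀ (B₁.e p₁).1), hf₀.add contDiffOn_const,
      fun y hy => (hdf₀ y hy).add_const _, by ring⟩
  let Q := shear ψ hbo hbψ hδ hf
  let Φ : PartialDiffeomorph (𝓡 3) (𝓡 3) M₁ M₂ ∞ := (B₁.e.trans Q).trans B₂.e.symm
  have hQ : ∀ x, Q x = (ψ x.1, δ * x.2 + f x.1) := fun x => rfl
  have hΦ : ∀ q, Φ q = B₂.e.symm (Q (B₁.e q)) := fun q => rfl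
  have hQp : Q (B₁.e p₁) = B₂.e p₂ := by rw [hQ, hψp, hfp]
  have hsource : ∀ q ∈ Φ.source, q ∈ B₁.e.source ∧ (B₁.e q).1 ∈ b ∧
      Φ q ∈ B₂.e.source ∧ B₂.e (Φ q) = Q (B₁.e q) := fun q hq => by
    obtain ⟨⟨hq1, hq2⟩, hq3⟩ := hq
    exact ⟨hq1, hq2.1, B₂.e.map_target hq3, B₂.e.right_inv hq3⟩
  -- With `df` substituted, the vertical component minus `F₂.a` of the base component is `δ` times
  -- the same difference for `F₁`. Hence graphs go to graphs.
  have hd : ∀ q ∈ Φ.source, ∀ u : TangentSpace (𝓡 3) q,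
      B₂.d (Φ q) (mfderiv (𝓡 3) (𝓡 3) Φ q u) =
        (fderiv ℝ ψ (B₁.e q).1 (B₁.d q u).1, δ * (B₁.d q u).2 +
          (F₂.a (ψ (B₁.e q).1) (fderiv ℝ ψ (B₁.e q).1 (B₁.d q u).1) -
            δ * F₁.a (B₁.e q).1 (B₁.d q u).1)) := by
    intro q hq u
    obtain ⟨hq1, hqb, hq2, hq3⟩ := hsource q hq
    have hψd : HasFDerivAt ψ (fderiv ℝ ψ (B₁.e q).1) (B₁.e q).1 :=
      ((hψc.contDiffAt (ψ.open_source.mem_nhds (hbψ hqb))).differentiableAt (by simp)).hasFDerivAt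
    have e1 := (fderiv_shear (δ := δ) hψd (hdf _ hqb)).hasMFDerivAt.comp q
      (B₁.e.mdifferentiableAt (by simp) hq1).hasMFDerivAt
    have e2 := (B₂.e.mdifferentiableAt (by simp) hq2).hasMFDerivAt.comp q
      (Φ.mdifferentiableAt (by simp) hq).hasMFDerivAt
    have hev : B₂.e ∘ Φ =ᶠ[𝓝 q] Q ∘ B₁.e := by
      filter_upwards [Φ.open_source.mem_nhds hq] with x hx using (hsource x hx).2.2.2
    have e3 := hasMFDerivAt_unique e2 (e1.congr_of_eventuallyEq hev)
    exact congrArg (fun L : EuclideanSpace ℝ (Fin 3) →L[ℝ] EuclideanSpace ℝ (Fin 2) × ℝ => L u) e3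
  have hfst : ∀ q ∈ Φ.source, (B₂.e (Φ q)).1 = ψ (B₁.e q).1 := fun q hq => by
    rw [(hsource q hq).2.2.2, hQ]
  have hmem : ∀ q ∈ Φ.source, ∀ u : TangentSpace (𝓡 3) q,
      mfderiv (𝓡 3) (𝓡 3) Φ q u ∈ S₂.D (Φ q) ↔ u ∈ S₁.D q := by
    intro q hq u
    obtain ⟨hq1, hqb, hq2, hq3⟩ := hsource q hq
    rw [F₂.mem_iff _ hq2, F₁.mem_iff _ hq1, hd q hq, hfst q hq]
    constructor
    · intro h
      have h' : δ * ((B₁.d q u).2 - F₁.a (B₁.e q).1 (B₁.d q u).1) = 0 := by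
        simp only at h; linarith
      rcases mul_eq_zero.1 h' with h0 | h0
      · exact absurd h0 hδ0
      · linarith
    · intro h
      simp only
      rw [h]; ring
  refine ⟨Φ, ⟨⟨hB₁, hpb, trivial⟩, ?_⟩, ?_, fun q hq => B₁.source_subset (hsource q hq).1,
    fun x hx => B₂.source_subset hx.1, fun q hq => ⟨fun w => ?_, fun u v hu hv => ?_⟩,
    fun q hq => ?_⟩
  · change Q (B₁.e p₁) ∈ B₂.e.target
    rw [hQp]
    exact B₂.e.map_source hB₂
  · rw [hΦ, hQp]
    exact symm_apply_apply B₂.e hB₂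
  · constructor
    · intro hw
      obtain ⟨u, rfl⟩ := (isInvertible_mfderiv_partialDiffeomorph Φ hq).surjective w
      exact ⟨u, (hmem q hq u).1 hw, rfl⟩
    · rintro ⟨u, hu, rfl⟩
      exact (hmem q hq u).2 hu
  · obtain ⟨hq1, hqb, hq2, hq3⟩ := hsource q hq
    rw [F₂.g_eq _ hq2, F₁.g_eq _ hq1, hfst q hq]
    simp only [hd q hq]
    exact hiso _ hqb _ _
  · obtain ⟨hq1, hqb, hq2, hq3⟩ := hsource q hq
    have h1 := hbψ hqb
    rw [B₁.fst_eq q hq1] at h1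
    obtain ⟨h2, h3, h4⟩ := mem_source_of_inCharts (B₁.proj_mem q hq1) h1
    -- Both points lie in the domain of one chart of `N₂` and have the same coordinates there.
    refine ⟨h2, (chartDiffeo (n := 2) (π₂ p₂)).injOn (B₂.proj_mem _ hq2) h3 ?_⟩
    have h5 := hfst q hq
    rw [B₁.fst_eq q hq1, B₂.fst_eq _ hq2] at h5
    exact h5.trans h4

end Isometry

end SubPR

end

theorem theorem2
    {M₁ : Type*} [TopologicalSpace M₁] [T2Space M₁]
    [ChartedSpace (EuclideanSpace ℝ (Fin 3)) M₁] [IsManifold (𝓡 3) ∞ M₁]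
    {M₂ : Type*} [TopologicalSpace M₂] [T2Space M₂]
    [ChartedSpace (EuclideanSpace ℝ (Fin 3)) M₂] [IsManifold (𝓡 3) ∞ M₂]
    {N₁ : Type*} [TopologicalSpace N₁] [T2Space N₁]
    [ChartedSpace (EuclideanSpace ℝ (Fin 2)) N₁] [IsManifold (𝓡 2) ∞ N₁]
    {N₂ : Type*} [TopologicalSpace N₂] [T2Space N₂]
    [ChartedSpace (EuclideanSpace ℝ (Fin 2)) N₂] [IsManifold (𝓡 2) ∞ N₂]
    (S₁ : SubPR.ContactStructure M₁) (S₂ : SubPR.ContactStructure M₂)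
    (h₁ : S₁.HVanishes) (h₂ : S₂.HVanishes)
    (U₁ : Set M₁) (R₁ : ∀ p : M₁, TangentSpace (𝓡 3) p) (π₁ : M₁ → N₁)
    (hπ₁ : S₁.IsReebQuotient U₁ R₁ π₁)
    (U₂ : Set M₂) (R₂ : ∀ p : M₂, TangentSpace (𝓡 3) p) (π₂ : M₂ → N₂)
    (hπ₂ : S₂.IsReebQuotient U₂ R₂ π₂) :
    (∃! g₁ : SubPR.SurfaceMetric N₁, S₁.IsProjection U₁ π₁ g₁) ∧
    (∃! g₂ : SubPR.SurfaceMetric N₂, S₂.IsProjection U₂ π₂ g₂) ∧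
    ∀ (g₁ : SubPR.SurfaceMetric N₁) (g₂ : SubPR.SurfaceMetric N₂),
      S₁.IsProjection U₁ π₁ g₁ → S₂.IsProjection U₂ π₂ g₂ →
      ∀ φ : PartialDiffeomorph (𝓡 2) (𝓡 2) N₁ N₂ ∞, SubPR.IsSurfaceIsometry g₁ g₂ φ →
      ∀ p₁ ∈ U₁, ∀ p₂ ∈ U₂, π₁ p₁ ∈ φ.source → φ (π₁ p₁) = π₂ p₂ →
      ∃ Φ : PartialDiffeomorph (𝓡 3) (𝓡 3) M₁ M₂ ∞,
        p₁ ∈ Φ.source ∧ Φ p₁ = p₂ ∧ Φ.source ⊆ U₁ ∧ Φ.target ⊆ U₂ ∧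
        SubPR.IsContactIsometry S₁ S₂ Φ ∧
        ∀ q ∈ Φ.source, π₁ q ∈ φ.source ∧ π₂ (Φ q) = φ (π₁ q) := by
  refine ⟨SubPR.existsUnique_projection hπ₁ h₁, SubPR.existsUnique_projection hπ₂ h₂, ?_⟩
  intro g₁ g₂ hg₁ hg₂ φ hφ p₁ hp₁ p₂ hp₂ hpφ hp
  exact SubPR.exists_contactIsometry hπ₁ h₁ hπ₂ h₂ hg₁ hg₂ hφ hp₁ hp₂ hpφ hp
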